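/- Let $\xi(s)=\frac12 s(s-1)\pi^{-s/2}\Gamma(\frac s2)\zeta(s)$, $\Xi(t)=\xi(\frac12+it)$, $\psi(t)=\sum_{n\ge1}e^{-\pi n^2t}$ $(t>0)$, $\Gamma(s,a)=\int_a^\infty t^{s-1}e^{-t}\,dt$, and let $\mu$ be the Möbius function. Let $$f(t)=\frac{\Xi(t)}{t^2+\frac14},\qquad f(x,y)=\frac1\pi\int_{\mathbb R}\frac{y}{y^2+(x-t)^2}\,f(t)\,dt\quad(y>0)$$ be the harmonic continuation (Poisson integral) of $f$. A series $\sum_{m\ge1}a_m$ is called $P$-summable with $P$-sum $S$ if for every $N$ the sum of $a_m$ over all $m\ge1$ whose prime factors are all less than $N$ converges, and these sums tend to $S$ as $N\to\infty$. For $x,y>0$ put $$D(x,y)=\frac{\pi}{x}\sum_{m=1}^{\infty}\frac{\mu(m)}{m}\sum_{n=1}^{\infty}e^{-2n\pi y/(mx)}\left(e^{\pi n/(mx)}-2e^{-\pi n/(mx)}\,\psi\!\left(e^{-4\pi n/(mx)}\right)\right),$$ where the sum over $m$ is taken in the sense of $P$-summability. Theorem. (1) For all $x,y>0$ the integral $f(x,y)$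 converges absolutely, the inner series over $n$ converge for every $m\ge 1$, the outer series over $m$ is $P$-summable, and $$f(x,y)=D(x,y).$$ (2) For every $x>0$, $$\lim_{y\to0^+}D(x,y)=\frac{\Xi(x)}{x^2+\frac14}.$$ (3) For every $y>0$ with $y\ne\frac12$, the series over $n$ below converges and $$\lim_{x\to0^+}D(x,y)=\frac{1}{y-\frac12}-\frac{2\,\xi(y+\frac12)}{(y+\frac12)(y-\frac12)}+\pi^{-(y+\frac12)/2}\sum_{n\ge1}n^{-y-\frac12}\,\Gamma\!\left(\frac{y+\frac12}{2},\pi n^2\right).$$ -/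

import Mathlib

open Filter Topology MeasureTheory Set

noncomputable section

namespace XiHarmonic

/-- The Riemann xi-function `ξ(s) = ½ s (s - 1) π^(-s/2) Γ(s/2) ζ(s)`. (At the removable
singularities of this formula, `s = 1` and `s = 0, -2, -4, …`, the value is a junk value; only
`s = ½ + i t` with `t` real and real `s > 1/2`, `s ≠ 1`, are used.) -/
def xi (s : ℂ) : ℂ :=
  1 / 2 * s * (s - 1) * (Real.pi : ℂ) ^ (-s / 2) * Complex.Gamma (s / 2) * riemannZeta s

/-- `Ξ(t) = ξ(½ + i t)` for real `t`. -/
def Xi (t : ℝ) : ℂ := xi (1 / 2 + Complex.I * t)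

/-- The boundary function `f(t) = Ξ(t) / (t² + ¼)`. -/
def f (t : ℝ) : ℂ := Xi t / ((t : ℂ) ^ 2 + 1 / 4)

/-- `ψ(t) = ∑_{n ≥ 1} exp(-π n² t)`, for `t > 0`. -/
def psi (t : ℝ) : ℝ := ∑' n : ℕ, Real.exp (-Real.pi * ((n : ℝ) + 1) ^ 2 * t)

/-- The (upper) incomplete gamma function `Γ(s, a) = ∫_a^∞ t^(s-1) e^(-t) dt`, for `a > 0`. -/
def upperGamma (s a : ℝ) : ℝ := ∫ t in Ioi a, t ^ (s - 1) * Real.exp (-t)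

/-- The integrand of the Poisson integral of `g` for the upper half-plane at `(x, y)`. -/
def poissonIntegrand (g : ℝ → ℂ) (x y t : ℝ) : ℂ :=
  ((y / (y ^ 2 + (x - t) ^ 2) : ℝ) : ℂ) * g t

/-- The harmonic continuation of `g` to the upper half-plane, i.e. its Poisson integral
`(1/π) ∫_ℝ y / (y² + (x - t)²) g(t) dt`. -/
def harmonicContinuation (g : ℝ → ℂ) (x y : ℝ) : ℂ :=
  1 / (Real.pi : ℂ) * ∫ t : ℝ, poissonIntegrand g x y t

/-- `∑_{m ≥ 1} a m` is `P`-summable to `S`: for every `N` the sum over those `m ≥ 1` all of whose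
prime factors are less than `N` converges, and these sums tend to `S` as `N → ∞`. -/
def HasPSum (a : ℕ → ℝ) (S : ℝ) : Prop :=
  (∀ N : ℕ, Summable fun m : Nat.smoothNumbers N => a m) ∧
    Tendsto (fun N : ℕ => ∑' m : Nat.smoothNumbers N, a m) atTop (𝓝 S)

/-- `∑_{m ≥ 1} a m` is `P`-summable. -/
def PSummable (a : ℕ → ℝ) : Prop := ∃ S, HasPSum a S

/-- The `P`-sum of `∑_{m ≥ 1} a m` (a junk value if the series is not `P`-summable). -/
def pSum (a : ℕ → ℝ) : ℝ :=
  limUnder atTop fun N : ℕ => ∑' m : Nat.smoothNumbers N, a m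

theorem HasPSum.pSum_eq {a : ℕ → ℝ} {S : ℝ} (h : HasPSum a S) : pSum a = S :=
  h.2.limUnder_eq

/-- The term with index `n` of the inner series:
`exp(-2nπy/(mx)) (exp(πn/(mx)) - 2 exp(-πn/(mx)) ψ(exp(-4πn/(mx))))`. -/
def innerTerm (x y : ℝ) (m n : ℕ) : ℝ :=
  Real.exp (-(2 * n * Real.pi * y) / (m * x)) *
    (Real.exp (Real.pi * n / (m * x)) -
      2 * Real.exp (-(Real.pi * n) / (m * x)) * psi (Real.exp (-(4 * Real.pi * n) / (m * x))))

/-- The term with index `m` of the outer series: `(μ(m)/m) ∑_{n ≥ 1} innerTerm x y m n`. -/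
def outerTerm (x y : ℝ) (m : ℕ) : ℝ :=
  (ArithmeticFunction.moebius m : ℝ) / m * ∑' n : ℕ, innerTerm x y m (n + 1)

/-- The term with index `n` of the series `∑_{n ≥ 1} n^(-s) Γ(s/2, π n²)`. -/
def gammaTerm (s : ℝ) (n : ℕ) : ℝ :=
  (n : ℝ) ^ (-s) * upperGamma (s / 2) (Real.pi * (n : ℝ) ^ 2)

end XiHarmonic

end

noncomputable section

namespace XiHarmonic

open scoped FourierTransform ArithmeticFunction.Moebius

/-! The function `f` is the Fourier transform of the even function g = `gfun`: on the critical line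
`f` is -1/2 times the completed zeta function, whose symmetric theta-integral representation, read
in t = e^{2u}, is the Laplace transform of g at ±it (`f_eq_integral`). Evenness of g is the
functional equation of theta. Taking the Poisson integral multiplies g by e^{-y|u|}, so the harmonic
continuation equals the Fourier integral `FC` (`harmonicContinuation_f`).

Up to a factor 2, the inner series samples g(u)e^{-y|u|} at positive multiples of h = 2π/(mx).
Poisson summation (`poisson_summation_damped`) turns it into a sum of `FC` over the multiples of mx,
plus two boundary terms, from the origin on each side. After division by m these become a constant
and a multiple of 1/m (`outerTerm_eq`). Over the divisors of the product of the primes below N, the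
sum of μ(d) vanishes for N ≥ 3 and the sum of μ(d)/d tends to 0, so both boundary terms disappear;
Möbius inversion of the sums over multiples leaves only `FC x y` (`hasPSum_moebius`).

The analytic input is decay. The holomorphic extension of g and Cauchy's estimate bound g, g', g''
by a multiple of e^{-|u|/2}, so `f` is O(1/(1+t²)), and its Poisson integral is O(1/x²) for fixed y.
Both boundary limits are dominated convergence in `FC` (`tendsto_FC`): at y = 0 it is `f`, and at x
= 0 it is a Laplace transform of g, rewritten by the symmetric formula for zeta and the incomplete
gamma series. -/

/-! ### Möbius sums over smooth numbers and P-summation -/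

/-- The product of the primes below `N`. -/
def primeProd (N : ℕ) : ℕ := ∏ p ∈ N.primesBelow, p

theorem primeProd_ne_zero (N : ℕ) : primeProd N ≠ 0 :=
  Finset.prod_ne_zero_iff.2 fun _ hp => (Nat.prime_of_mem_primesBelow hp).ne_zero

theorem primeFactors_primeProd (N : ℕ) : (primeProd N).primeFactors = N.primesBelow :=
  Nat.primeFactors_prod fun _ hp => Nat.prime_of_mem_primesBelow hp

theorem squarefree_primeProd (N : ℕ) : Squarefree (primeProd N) := by
  unfold primeProd
  refine Finset.squarefree_prod_of_pairwise_isCoprime (fun p hp q hq hpq => ?_)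
    fun p hp => (Nat.prime_of_mem_primesBelow hp).squarefree
  exact Nat.coprime_iff_isRelPrime.1 ((Nat.coprime_primes (Nat.prime_of_mem_primesBelow hp)
    (Nat.prime_of_mem_primesBelow hq)).2 hpq)

theorem mem_smoothNumbers_of_dvd_primeProd {N m : ℕ} (h : m ∣ primeProd N) :
    m ∈ Nat.smoothNumbers N := by
  rw [Nat.mem_smoothNumbers']
  intro p hp hpm
  have : p ∈ (primeProd N).primeFactors :=
    Nat.mem_primeFactors.2 ⟨hp, hpm.trans h, primeProd_ne_zero N⟩
  rw [primeFactors_primeProd] at this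
  exact Nat.lt_of_mem_primesBelow this

theorem dvd_primeProd_of_mem_smoothNumbers {N m : ℕ} (h : m ∈ Nat.smoothNumbers N)
    (hm : Squarefree m) : m ∣ primeProd N := by
  rw [← Nat.prod_primeFactors_of_squarefree hm]
  refine Finset.prod_dvd_prod_of_subset _ _ _ fun p hp => ?_
  have hp' := Nat.mem_primeFactors.1 hp
  exact Nat.mem_primesBelow.2 ⟨Nat.mem_smoothNumbers'.1 h p hp'.1 hp'.2.1, hp'.1⟩

/-- A smooth number that does not divide the product of the primes below N is not squarefree, so μ
kills it. Hence the sums in the definition of P-summability are finite divisor sums. -/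
theorem indicator_smoothNumbers_moebius_eq_zero {N m : ℕ} (X : ℕ → ℝ)
    (hm : m ∉ (primeProd N).divisors) :
    (Nat.smoothNumbers N).indicator (fun m => (μ m : ℝ) * X m) m = 0 := by
  by_cases h : m ∈ Nat.smoothNumbers N
  · rw [indicator_of_mem h]
    have : ¬ Squarefree m := fun hs => hm
      (Nat.mem_divisors.2 ⟨dvd_primeProd_of_mem_smoothNumbers h hs, primeProd_ne_zero N⟩)
    simp [ArithmeticFunction.moebius_eq_zero_of_not_squarefree this]
  · exact indicator_of_notMem h _

theorem summable_smoothNumbers_moebius (N : ℕ) (X : ℕ → ℝ) :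
    Summable fun m : Nat.smoothNumbers N => (μ m : ℝ) * X m :=
  (summable_subtype_iff_indicator (f := fun m : ℕ => (μ m : ℝ) * X m)).2 <|
    summable_of_ne_finset_zero (s := (primeProd N).divisors)
      fun _ hm => indicator_smoothNumbers_moebius_eq_zero X hm

theorem tsum_smoothNumbers_moebius (N : ℕ) (X : ℕ → ℝ) :
    ∑' m : Nat.smoothNumbers N, (μ m : ℝ) * X m =
      ∑ d ∈ (primeProd N).divisors, (μ d : ℝ) * X d := by
  rw [tsum_subtype (Nat.smoothNumbers N) (fun m : ℕ => (μ m : ℝ) * X m),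
    tsum_eq_sum (s := (primeProd N).divisors)
      fun _ hm => indicator_smoothNumbers_moebius_eq_zero X hm]
  refine Finset.sum_congr rfl fun m hm => indicator_of_mem ?_ _
  exact mem_smoothNumbers_of_dvd_primeProd (Nat.dvd_of_mem_divisors hm)

theorem sum_divisors_moebius (n : ℕ) :
    ∑ d ∈ n.divisors, (μ d : ℝ) = if n = 1 then 1 else 0 := by
  have h := congrArg (fun f : ArithmeticFunction ℝ => f n)
    (ArithmeticFunction.coe_zeta_mul_coe_moebius (R := ℝ))
  simpa only [ArithmeticFunction.coe_zeta_mul_apply, ArithmeticFunction.one_apply,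
    ArithmeticFunction.intCoe_apply] using h

theorem primeProd_ne_one {N : ℕ} (hN : 3 ≤ N) : primeProd N ≠ 1 := by
  intro h
  have h2 : 2 ∈ (primeProd N).primeFactors := by
    rw [primeFactors_primeProd]
    exact Nat.mem_primesBelow.2 ⟨by omega, Nat.prime_two⟩
  simp [h] at h2

/-- The sum factors as ∏(1 - 1/p), which is at most exp(-∑ 1/p), and the sum of the reciprocals of
the primes diverges. -/
theorem tendsto_sum_divisors_moebius_div :
    Tendsto (fun N => ∑ d ∈ (primeProd N).divisors, (μ d : ℝ) * (1 / d)) atTop (𝓝 0) := by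
  have key : ∀ N, ∑ d ∈ (primeProd N).divisors, (μ d : ℝ) * (1 / d) =
      ∏ p ∈ N.primesBelow, (1 - 1 / (p : ℝ)) := by
    intro N
    let z : ArithmeticFunction ℝ := ⟨fun n => 1 / (n : ℝ), by simp⟩
    have hz : z.IsMultiplicative := by
      refine ⟨by simp [z], fun {m n} _ => ?_⟩
      simp [z, mul_comm]
    have := ArithmeticFunction.IsMultiplicative.prodPrimeFactors_one_sub_of_squarefree z hz
      (squarefree_primeProd N)
    rw [primeFactors_primeProd] at this
    exact this.symm
  simp_rw [key]
  have hdiv : Tendsto (fun N : ℕ => ∑ p ∈ N.primesBelow, 1 / (p : ℝ)) atTop atTop := by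
    have := (not_summable_iff_tendsto_nat_atTop_of_nonneg
      (fun n => indicator_nonneg (fun _ _ => by positivity) n)).1
      not_summable_one_div_on_primes
    refine this.congr fun N => ?_
    rw [Nat.primesBelow, Finset.sum_filter]
    exact Finset.sum_congr rfl fun n _ => by simp [Set.indicator_apply]
  refine squeeze_zero (fun N => Finset.prod_nonneg fun p hp => ?_) (fun N => ?_)
    (Real.tendsto_exp_neg_atTop_nhds_zero.comp hdiv)
  · have := (Nat.prime_of_mem_primesBelow hp).one_lt.le
    rw [sub_nonneg, div_le_one (by positivity)]
    exact_mod_cast this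
  · simp only [Function.comp]
    rw [← Finset.sum_neg_distrib, Real.exp_sum]
    refine Finset.prod_le_prod (fun p hp => ?_) fun p hp => ?_
    · have := (Nat.prime_of_mem_primesBelow hp).one_lt.le
      rw [sub_nonneg, div_le_one (by positivity)]
      exact_mod_cast this
    · have := Real.add_one_le_exp (-(1 / (p : ℝ)))
      linarith

/-- Möbius inversion of the sums of `c` over the multiples of `d`, restricted to the divisors of
`Q`: the terms that survive are those prime to `Q`. -/
theorem sum_divisors_moebius_mul_tsum {c : ℕ → ℝ} (hc : Summable c) {Q : ℕ} (hQ : Q ≠ 0) :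
    ∑ d ∈ Q.divisors, (μ d : ℝ) * ∑' k : ℕ, c (d * (k + 1)) =
      ∑' k : ℕ, if (k + 1).Coprime Q then c (k + 1) else 0 := by
  have key : ∀ d ∈ Q.divisors, HasSum (fun k : ℕ => if d ∣ k + 1 then c (k + 1) else 0)
      (∑' k : ℕ, c (d * (k + 1))) := by
    intro d hd
    have hd0 : 0 < d := Nat.pos_of_mem_divisors hd
    -- Positive integers are indexed as k + 1, so the multiple d(k + 1) sits at index d(k + 1) - 1.
    have hinj : Function.Injective fun k : ℕ => d * (k + 1) - 1 := by
      intro a b hab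
      have ha : 1 ≤ d * (a + 1) := Nat.mul_pos hd0 (Nat.succ_pos _)
      have hb : 1 ≤ d * (b + 1) := Nat.mul_pos hd0 (Nat.succ_pos _)
      have : d * (a + 1) = d * (b + 1) := by
        simp only at hab
        omega
      simpa using Nat.eq_of_mul_eq_mul_left hd0 this
    have hs : ∀ k ∉ Set.range (fun k : ℕ => d * (k + 1) - 1),
        (if d ∣ k + 1 then c (k + 1) else 0) = 0 := by
      intro k hk
      rw [if_neg]
      rintro ⟨j, hj⟩
      refine hk ⟨j - 1, ?_⟩
      have hj0 : j ≠ 0 := by rintro rfl; simp at hj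
      simp only
      rw [Nat.sub_add_cancel (by omega), ← hj]
      simp
    rw [← hinj.hasSum_iff hs]
    have : ((fun k : ℕ => if d ∣ k + 1 then c (k + 1) else 0) ∘ fun k : ℕ => d * (k + 1) - 1) =
        fun k => c (d * (k + 1)) := by
      funext k
      have ha : 1 ≤ d * (k + 1) := Nat.mul_pos hd0 (Nat.succ_pos _)
      simp only [Function.comp]
      rw [Nat.sub_add_cancel ha, if_pos (dvd_mul_right _ _)]
    rw [this]
    refine Summable.hasSum (hc.comp_injective (i := fun k : ℕ => d * (k + 1)) fun a b hab => ?_)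
    simpa using Nat.eq_of_mul_eq_mul_left hd0 hab
  have hsum : HasSum (fun k : ℕ => ∑ d ∈ Q.divisors,
      (μ d : ℝ) * if d ∣ k + 1 then c (k + 1) else 0)
      (∑ d ∈ Q.divisors, (μ d : ℝ) * ∑' k : ℕ, c (d * (k + 1))) :=
    hasSum_sum fun d hd => (key d hd).mul_left _
  rw [← hsum.tsum_eq]
  refine tsum_congr fun k => ?_
  -- After exchanging the sums, the coefficient of c(k + 1) is the sum of μ over the divisors of
  -- gcd(k + 1, Q), which detects coprimality.
  have hdiv : (Nat.gcd (k + 1) Q).divisors = Q.divisors.filter (· ∣ k + 1) := by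
    ext d
    simp only [Nat.mem_divisors, Finset.mem_filter, Nat.dvd_gcd_iff]
    have hg : Nat.gcd (k + 1) Q ≠ 0 := Nat.gcd_ne_zero_right hQ
    tauto
  have := sum_divisors_moebius ((k + 1).gcd Q)
  rw [hdiv, Finset.sum_filter] at this
  calc ∑ d ∈ Q.divisors, (μ d : ℝ) * (if d ∣ k + 1 then c (k + 1) else 0)
      = (∑ d ∈ Q.divisors, if d ∣ k + 1 then (μ d : ℝ) else 0) * c (k + 1) := by
        rw [Finset.sum_mul]
        refine Finset.sum_congr rfl fun d _ => ?_
        split_ifs <;> simp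
    _ = _ := by
        rw [this]
        by_cases h : (k + 1).gcd Q = 1
        · rw [if_pos h, if_pos (Nat.coprime_iff_gcd_eq_one.2 h), one_mul]
        · rw [if_neg h, if_neg (mt Nat.coprime_iff_gcd_eq_one.1 h), zero_mul]

/-- Each integer k + 1 > 1 has a prime factor, so its term drops out once N > k + 1; |c| dominates.
-/
theorem tendsto_sum_divisors_moebius_mul_tsum {c : ℕ → ℝ} (hc : Summable c) :
    Tendsto (fun N => ∑ d ∈ (primeProd N).divisors, (μ d : ℝ) * ∑' k : ℕ, c (d * (k + 1)))
      atTop (𝓝 (c 1)) := by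
  simp_rw [fun N => sum_divisors_moebius_mul_tsum hc (primeProd_ne_zero N)]
  have h1 : c 1 = ∑' k : ℕ, if k = 0 then c 1 else 0 := by rw [tsum_ite_eq]
  rw [h1]
  have hc1 : Summable fun k : ℕ => |c (k + 1)| := ((summable_nat_add_iff 1).2 hc).abs
  refine tendsto_tsum_of_dominated_convergence hc1 (fun k => ?_) (Eventually.of_forall ?_)
  · rcases Nat.eq_zero_or_pos k with rfl | hk
    · simp
    · refine tendsto_const_nhds.congr' ?_
      filter_upwards [eventually_gt_atTop (k + 1)] with N hN
      rw [if_neg hk.ne', if_neg]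
      intro hcop
      obtain ⟨p, hp, hpk⟩ := Nat.exists_prime_and_dvd (n := k + 1) (by omega)
      have hpN : p ∣ primeProd N := Finset.dvd_prod_of_mem (fun p => p)
        (Nat.mem_primesBelow.2 ⟨(Nat.le_of_dvd (by omega) hpk).trans_lt hN, hp⟩)
      exact hp.one_lt.ne' (Nat.dvd_one.1 (hcop ▸ Nat.dvd_gcd hpk hpN))
  · intro N k
    split_ifs <;> simp

/-- The shape matches Poisson summation: A and B/m are its two boundary terms, and neither
contributes in the limit. -/
theorem hasPSum_moebius {c : ℕ → ℝ} (hc : Summable c) (A B : ℝ) :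
    HasPSum (fun m => (μ m : ℝ) * (A + ∑' k : ℕ, c (m * (k + 1)) - B / m)) (c 1) := by
  refine ⟨fun N => summable_smoothNumbers_moebius N
    fun m => A + ∑' k : ℕ, c (m * (k + 1)) - B / m, ?_⟩
  have h := (tendsto_sum_divisors_moebius_mul_tsum hc).sub
    (tendsto_sum_divisors_moebius_div.const_mul B)
  rw [mul_zero, sub_zero] at h
  refine h.congr' ?_
  -- From N = 3 on, the prime 2 divides the product, so the divisor sum of μ is exactly 0.
  filter_upwards [eventually_ge_atTop 3] with N hN
  have h0 : ∑ d ∈ (primeProd N).divisors, (μ d : ℝ) = 0 := by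
    rw [sum_divisors_moebius, if_neg (primeProd_ne_one hN)]
  calc _ = A * ∑ d ∈ (primeProd N).divisors, (μ d : ℝ) +
        ∑ d ∈ (primeProd N).divisors, (μ d : ℝ) * ∑' k : ℕ, c (d * (k + 1)) -
        B * ∑ d ∈ (primeProd N).divisors, (μ d : ℝ) * (1 / d) := by rw [h0, mul_zero, zero_add]
    _ = ∑ d ∈ (primeProd N).divisors,
        (μ d : ℝ) * (A + ∑' k : ℕ, c (d * (k + 1)) - B / d) := by
      rw [Finset.mul_sum, Finset.mul_sum, ← Finset.sum_add_distrib, ← Finset.sum_sub_distrib]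
      exact Finset.sum_congr rfl fun d _ => by ring
    _ = _ := (tsum_smoothNumbers_moebius N
      fun m => A + ∑' k : ℕ, c (m * (k + 1)) - B / m).symm

/-! ### The theta function -/

theorem hasSum_ofReal_psi_term {t : ℝ} (ht : 0 < t) :
    HasSum (fun n : ℕ => ((Real.exp (-Real.pi * ((n : ℝ) + 1) ^ 2 * t) : ℝ) : ℂ))
      ((jacobiTheta (Complex.I * t) - 1) / 2) := by
  have h := hasSum_nat_jacobiTheta (τ := Complex.I * t) (by simpa using ht)
  refine h.congr_fun fun n => ?_
  push_cast
  congr 1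
  linear_combination (-(Real.pi : ℂ) * (n + 1) ^ 2 * t) * Complex.I_sq

theorem ofReal_psi {t : ℝ} (ht : 0 < t) :
    (psi t : ℂ) = (jacobiTheta (Complex.I * t) - 1) / 2 := by
  rw [← (hasSum_ofReal_psi_term ht).tsum_eq, psi, Complex.ofReal_tsum]

theorem psi_nonneg (t : ℝ) : 0 ≤ psi t := tsum_nonneg fun _ => (Real.exp_pos _).le

theorem evenKernel_zero_eq {t : ℝ} (ht : 0 < t) : HurwitzZeta.evenKernel 0 t = 1 + 2 * psi t := by
  have h := HurwitzZeta.evenKernel_def 0 t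
  rw [← Complex.ofReal_inj]
  push_cast
  rw [ofReal_psi ht, ← QuotientAddGroup.mk_zero]
  rw [h, jacobiTheta_eq_jacobiTheta₂]
  simp
  ring

theorem psi_functional_equation {t : ℝ} (ht : 0 < t) :
    1 + 2 * psi t = 1 / t ^ (1 / 2 : ℝ) * (1 + 2 * psi (1 / t)) := by
  have h := HurwitzZeta.evenKernel_functional_equation 0 t
  rwa [← HurwitzZeta.evenKernel_eq_cosKernel_of_zero, evenKernel_zero_eq ht,
    evenKernel_zero_eq (one_div_pos.2 ht)] at h

theorem psi_le {t : ℝ} (ht : 1 ≤ t) : psi t ≤ 2 * Real.exp (-Real.pi * t) := by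
  have ht0 : 0 < t := by linarith
  have h := norm_jacobiTheta_sub_one_le (τ := Complex.I * t) (by simpa using ht0)
  have h2 : ‖(psi t : ℂ)‖ = ‖jacobiTheta (Complex.I * t) - 1‖ / 2 := by
    rw [ofReal_psi ht0, norm_div, Complex.norm_two]
  rw [Complex.norm_real, Real.norm_of_nonneg (psi_nonneg t)] at h2
  have him : (Complex.I * (t : ℂ)).im = t := by simp
  rw [him] at h
  have he : Real.exp (-Real.pi * t) ≤ 1 / 2 := by
    have h3 : Real.exp (-Real.pi * t) ≤ Real.exp (-1) :=
      Real.exp_le_exp.2 (by nlinarith [Real.pi_gt_three])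
    have h4 := Real.exp_neg_one_lt_d9
    linarith
  have h5 : 2 / (1 - Real.exp (-Real.pi * t)) ≤ 4 := by
    rw [div_le_iff₀ (by linarith)]
    linarith
  have h6 := mul_le_mul_of_nonneg_right h5 (Real.exp_pos (-Real.pi * t)).le
  rw [h2]
  linarith

/-! ### The even function g: holomorphic extension and decay -/

/-- The function `e^{-u/2}/2 - e^{u/2} ψ(e^{2u})`, whose Fourier transform is `f`. -/
def gfun (u : ℝ) : ℝ :=
  Real.exp (-u / 2) / 2 - Real.exp (u / 2) * psi (Real.exp (2 * u))

/-- This is the functional equation of theta at t = e^{2u}, multiplied by e^{u/2}/2. -/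
theorem gfun_neg (u : ℝ) : gfun (-u) = gfun u := by
  have h := psi_functional_equation (Real.exp_pos (2 * u))
  have e1 : (Real.exp (2 * u)) ^ (1 / 2 : ℝ) = Real.exp u := by
    rw [← Real.exp_mul]; ring_nf
  have e2 : 1 / Real.exp (2 * u) = Real.exp (2 * -u) := by
    rw [one_div, ← Real.exp_neg]; ring_nf
  rw [e1, e2, one_div, ← Real.exp_neg] at h
  have e3 : Real.exp (-u / 2) = Real.exp (u / 2) * Real.exp (-u) := by
    rw [← Real.exp_add]; ring_nf
  have e4 : Real.exp (-u) * Real.exp (u / 2) * Real.exp (u / 2) = 1 := by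
    rw [← Real.exp_add, ← Real.exp_add, Real.exp_eq_one_iff]; ring
  unfold gfun
  rw [neg_neg, e3]
  linear_combination Real.exp (u / 2) / 2 * h

/-- The holomorphic extension of `gfun` to a strip. -/
def gC (z : ℂ) : ℂ :=
  Complex.exp (-z / 2) / 2 -
    Complex.exp (z / 2) * ((jacobiTheta (Complex.I * Complex.exp (2 * z)) - 1) / 2)

theorem gC_ofReal (u : ℝ) : gC u = (gfun u : ℂ) := by
  unfold gC gfun
  push_cast
  rw [ofReal_psi (Real.exp_pos _)]
  push_cast
  rfl

theorem im_I_mul_exp (z : ℂ) :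
    (Complex.I * Complex.exp (2 * z)).im = Real.exp (2 * z.re) * Real.cos (2 * z.im) := by
  rw [Complex.I_mul_im, Complex.exp_re]
  simp

/-- An open strip on which `gC` is holomorphic. -/
def strip : Set ℂ := {z | |z.im| < 3 / 4}

theorem isOpen_strip : IsOpen strip := isOpen_lt (by fun_prop) (by fun_prop)

/-- Theta needs i·e^{2z} in the upper half-plane, that is cos(2 Im z) > 0; the strip ensures this
because 3/2 < π/2. -/
theorem differentiableOn_gC : DifferentiableOn ℂ gC strip := by
  intro z hz
  have hz' : |z.im| < 3 / 4 := hz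
  rw [abs_lt] at hz'
  have him : 0 < (Complex.I * Complex.exp (2 * z)).im := by
    rw [im_I_mul_exp]
    refine mul_pos (Real.exp_pos _) (Real.cos_pos_of_mem_Ioo ⟨?_, ?_⟩) <;>
      linarith [Real.pi_gt_d2]
  have h1 : DifferentiableAt ℂ (fun z => jacobiTheta (Complex.I * Complex.exp (2 * z))) z :=
    (differentiableAt_jacobiTheta him).comp (f := fun z => Complex.I * Complex.exp (2 * z)) z
      (by fun_prop)
  refine DifferentiableAt.differentiableWithinAt ?_
  unfold gC
  fun_prop

/-- Only a right half-strip is needed, since evenness handles negative u. Starting at Re z = -1/2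
with |Im z| ≤ 1/2 leaves room for two Cauchy estimates of radius 1/4. -/
theorem exists_norm_gC_le : ∃ C, 0 ≤ C ∧ ∀ z : ℂ, |z.im| ≤ 1 / 2 → -(1 / 2) ≤ z.re →
    ‖gC z‖ ≤ C * Real.exp (-z.re / 2) := by
  -- A lower bound for Im(i·e^{2z}) on the half-strip: e^{2 Re z} ≥ e^{-1} and cos(2 Im z) ≥ 1/2.
  set a := Real.exp (-1) / 2 with ha
  have ha0 : 0 < a := by positivity
  set K := 2 / (1 - Real.exp (-Real.pi * a)) with hK
  have hlt : Real.exp (-Real.pi * a) < 1 :=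
    Real.exp_lt_one_iff.2 (by nlinarith [Real.pi_pos])
  have hK0 : 0 ≤ K := div_nonneg zero_le_two (by linarith)
  refine ⟨1 / 2 + K / 2, by positivity, fun z hz hr => ?_⟩
  rw [abs_le] at hz
  have hcos : 1 / 2 ≤ Real.cos (2 * z.im) := by
    rw [← Real.cos_abs, ← Real.cos_pi_div_three]
    refine Real.cos_le_cos_of_nonneg_of_le_pi (abs_nonneg _) (by linarith [Real.pi_pos]) ?_
    rw [abs_le]
    constructor <;> linarith [Real.pi_gt_three]
  have him : Real.exp (2 * z.re) / 2 ≤ (Complex.I * Complex.exp (2 * z)).im := by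
    rw [im_I_mul_exp]
    nlinarith [Real.exp_pos (2 * z.re)]
  have hbase : a ≤ (Complex.I * Complex.exp (2 * z)).im := by
    refine le_trans ?_ him
    rw [ha]
    gcongr
    linarith
  set T := (Complex.I * Complex.exp (2 * z)).im with hT
  have hθ := norm_jacobiTheta_sub_one_le (τ := Complex.I * Complex.exp (2 * z))
    (ha0.trans_le hbase)
  rw [← hT] at hθ
  -- Uses πT ≥ e^{2 Re z} ≥ 1 + 2 Re z.
  have hE : Real.exp (-Real.pi * T) ≤ Real.exp (-1 - 2 * z.re) := by
    refine Real.exp_le_exp.2 ?_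
    have := Real.add_one_le_exp (2 * z.re)
    nlinarith [Real.pi_gt_three, Real.exp_pos (2 * z.re)]
  have hK' : 2 / (1 - Real.exp (-Real.pi * T)) ≤ K := by
    rw [hK]
    have : Real.exp (-Real.pi * T) ≤ Real.exp (-Real.pi * a) :=
      Real.exp_le_exp.2 (by nlinarith [Real.pi_pos])
    exact div_le_div_of_nonneg_left zero_le_two (by linarith) (by linarith)
  have hθ' : ‖jacobiTheta (Complex.I * Complex.exp (2 * z)) - 1‖ ≤
      K * Real.exp (-1 - 2 * z.re) :=
    hθ.trans (mul_le_mul hK' hE (Real.exp_pos _).le hK0)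
  have n1 : ‖Complex.exp (-z / 2) / 2‖ = 1 / 2 * Real.exp (-z.re / 2) := by
    rw [norm_div, Complex.norm_exp, Complex.norm_two]
    have : (-z / 2).re = -z.re / 2 := by simp
    rw [this]; ring
  have n2 : ‖Complex.exp (z / 2)‖ = Real.exp (z.re / 2) := by
    rw [Complex.norm_exp]
    have : (z / 2).re = z.re / 2 := by simp
    rw [this]
  have n3 : Real.exp (z.re / 2) * Real.exp (-1 - 2 * z.re) ≤ Real.exp (-z.re / 2) := by
    rw [← Real.exp_add]
    exact Real.exp_le_exp.2 (by linarith)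
  calc ‖gC z‖ ≤ ‖Complex.exp (-z / 2) / 2‖ + ‖Complex.exp (z / 2) *
        ((jacobiTheta (Complex.I * Complex.exp (2 * z)) - 1) / 2)‖ := norm_sub_le _ _
    _ ≤ 1 / 2 * Real.exp (-z.re / 2) +
        Real.exp (z.re / 2) * (K * Real.exp (-1 - 2 * z.re) / 2) := by
      rw [n1, norm_mul, n2, norm_div, Complex.norm_two]
      gcongr
    _ = 1 / 2 * Real.exp (-z.re / 2) +
        K / 2 * (Real.exp (z.re / 2) * Real.exp (-1 - 2 * z.re)) := by ring
    _ ≤ 1 / 2 * Real.exp (-z.re / 2) + K / 2 * Real.exp (-z.re / 2) := by gcongr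
    _ = _ := by ring

/-- Cauchy's estimate for functions with exponential decay on a half-strip. -/
theorem norm_deriv_le_exp {h : ℂ → ℂ} (hd : DifferentiableOn ℂ h strip) {r C : ℝ} (hC : 0 ≤ C)
    (hr : r ≤ 1 / 4)
    (hb : ∀ z : ℂ, |z.im| ≤ r + 1 / 4 → -(r + 1 / 4) ≤ z.re → ‖h z‖ ≤ C * Real.exp (-z.re / 2))
    {z : ℂ} (hz : |z.im| ≤ r) (hz' : -r ≤ z.re) :
    ‖deriv h z‖ ≤ 4 * C * Real.exp 1 * Real.exp (-z.re / 2) := by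
  have key : ∀ w : ℂ, ‖w - z‖ ≤ 1 / 4 → |w.im - z.im| ≤ 1 / 4 ∧ |w.re - z.re| ≤ 1 / 4 :=
    fun w hw => ⟨(Complex.abs_im_le_norm (w - z)).trans hw,
      (Complex.abs_re_le_norm (w - z)).trans hw⟩
  have hsub : Metric.closedBall z (1 / 4) ⊆ strip := by
    intro w hw
    rw [mem_closedBall_iff_norm] at hw
    have := (key w hw).1
    change |w.im| < 3 / 4
    rw [abs_le] at *
    rw [abs_lt]
    constructor <;> linarith
  have hD : DiffContOnCl ℂ h (Metric.ball z (1 / 4)) :=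
    (hd.mono (Metric.closure_ball_subset_closedBall.trans hsub)).diffContOnCl
  have := Complex.norm_deriv_le_of_forall_mem_sphere_norm_le (c := z) (R := 1 / 4)
    (C := C * (Real.exp 1 * Real.exp (-z.re / 2))) (by norm_num) hD ?_
  · refine this.trans (le_of_eq ?_)
    ring
  · intro w hw
    have hw' : ‖w - z‖ ≤ 1 / 4 := (mem_sphere_iff_norm.1 hw).le
    obtain ⟨h1, h2⟩ := key w hw'
    rw [abs_le] at h1 h2 hz
    refine (hb w (abs_le.2 ⟨by linarith, by linarith⟩) (by linarith)).trans ?_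
    rw [← Real.exp_add]
    gcongr
    linarith

/-- `gfun` as a complex-valued function. -/
def gR (u : ℝ) : ℂ := (gfun u : ℂ)

theorem ofReal_mem_strip (u : ℝ) : (u : ℂ) ∈ strip := by
  change |(u : ℂ).im| < 3 / 4
  simp

theorem hasDerivAt_gR (u : ℝ) : HasDerivAt gR (deriv gC u) u := by
  have h := (differentiableOn_gC.differentiableAt
    (isOpen_strip.mem_nhds (ofReal_mem_strip u))).hasDerivAt.comp_ofReal
  simp_rw [gC_ofReal] at h
  exact h

theorem hasDerivAt_deriv_gR (u : ℝ) : HasDerivAt (deriv gR) (deriv (deriv gC) u) u := by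
  have h := ((differentiableOn_gC.deriv isOpen_strip).differentiableAt
    (isOpen_strip.mem_nhds (ofReal_mem_strip u))).hasDerivAt.comp_ofReal
  have h2 : deriv gR = fun u : ℝ => deriv gC u := funext fun u => (hasDerivAt_gR u).deriv
  rwa [h2]

theorem gR_neg (u : ℝ) : gR (-u) = gR u := by rw [gR, gfun_neg, gR]

theorem deriv_gR_neg (u : ℝ) : deriv gR (-u) = -deriv gR u := by
  have h := deriv_comp_neg gR u
  simp_rw [gR_neg] at h
  rw [h, neg_neg]

theorem deriv_deriv_gR_neg (u : ℝ) : deriv (deriv gR) (-u) = deriv (deriv gR) u := by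
  have h := deriv_comp_neg (deriv gR) u
  simp_rw [deriv_gR_neg] at h
  rw [deriv.fun_neg] at h
  exact (neg_injective h).symm

/-- Two Cauchy estimates shrink the half-strip margin from 1/2 to 1/4 to 0; parity of g, g', g''
then covers u < 0. -/
theorem exists_bound_gR : ∃ C, ∀ u : ℝ, ‖gR u‖ ≤ C * Real.exp (-|u| / 2) ∧
    ‖deriv gR u‖ ≤ C * Real.exp (-|u| / 2) ∧ ‖deriv (deriv gR) u‖ ≤ C * Real.exp (-|u| / 2) := by
  obtain ⟨C, hC, hb⟩ := exists_norm_gC_le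
  have h1 : ∀ z : ℂ, |z.im| ≤ 1 / 4 → -(1 / 4) ≤ z.re →
      ‖deriv gC z‖ ≤ 4 * C * Real.exp 1 * Real.exp (-z.re / 2) := fun z hz hz' =>
    norm_deriv_le_exp differentiableOn_gC hC le_rfl
      (fun w hw hw' => hb w (hw.trans (by norm_num)) (le_trans (by norm_num) hw')) hz hz'
  have h2 : ∀ z : ℂ, |z.im| ≤ 0 → -0 ≤ z.re → ‖deriv (deriv gC) z‖ ≤
      4 * (4 * C * Real.exp 1) * Real.exp 1 * Real.exp (-z.re / 2) := fun z hz hz' =>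
    norm_deriv_le_exp (differentiableOn_gC.deriv isOpen_strip) (by positivity) (by norm_num)
      (fun w hw hw' => h1 w (hw.trans (by norm_num)) (le_trans (by norm_num) hw')) hz hz'
  set M := 4 * (4 * C * Real.exp 1) * Real.exp 1 with hM
  have he : 1 ≤ Real.exp 1 := Real.one_le_exp zero_le_one
  have hM1 : 4 * C * Real.exp 1 ≤ M := by
    have : 0 ≤ 4 * C * Real.exp 1 := by positivity
    nlinarith
  have hM0 : C ≤ M := by nlinarith
  have pos : ∀ u : ℝ, 0 ≤ u → ‖gR u‖ ≤ M * Real.exp (-u / 2) ∧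
      ‖deriv gR u‖ ≤ M * Real.exp (-u / 2) ∧
      ‖deriv (deriv gR) u‖ ≤ M * Real.exp (-u / 2) := by
    intro u hu
    refine ⟨?_, ?_, ?_⟩
    · have := hb u (by simp) (by simp; linarith)
      rw [gC_ofReal, Complex.ofReal_re] at this
      exact this.trans (by gcongr)
    · have := h1 u (by simp) (by simp; linarith)
      rw [(hasDerivAt_gR u).deriv]
      rw [Complex.ofReal_re] at this
      exact this.trans (by gcongr)
    · have := h2 u (by simp) (by simpa using hu)
      rw [(hasDerivAt_deriv_gR u).deriv]
      rw [Complex.ofReal_re] at this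
      exact this
  refine ⟨M, fun u => ?_⟩
  rcases le_total 0 u with hu | hu
  · rw [abs_of_nonneg hu]; exact pos u hu
  · rw [abs_of_nonpos hu]
    have := pos (-u) (by linarith)
    rwa [gR_neg, deriv_gR_neg, norm_neg, deriv_deriv_gR_neg] at this

theorem continuous_gR : Continuous gR :=
  continuous_iff_continuousAt.2 fun u => (hasDerivAt_gR u).continuousAt

theorem integrable_exp_neg_abs {a : ℝ} (ha : 0 < a) :
    Integrable fun u : ℝ => Real.exp (-(a * |u|)) := by
  have hpos : IntegrableOn (fun u : ℝ => Real.exp (-(a * |u|))) (Ioi 0) := by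
    refine (exp_neg_integrableOn_Ioi 0 ha).congr_fun (fun u hu => ?_) measurableSet_Ioi
    have hu' : 0 < u := hu
    simp only [abs_of_pos hu', neg_mul]
  have hneg : IntegrableOn (fun u : ℝ => Real.exp (-(a * |u|))) (Iic 0) := by
    refine (integrableOn_exp_mul_Iic ha 0).congr_fun (fun u hu => ?_) measurableSet_Iic
    have hu' : u ≤ 0 := hu
    simp only [abs_of_nonpos hu', mul_neg, neg_neg]
  rw [← integrableOn_univ, ← Iic_union_Ioi (a := (0 : ℝ))]
  exact hneg.union hpos

theorem integrable_of_norm_le_exp {E : Type*} [NormedAddCommGroup E] {h : ℝ → E}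
    (hh : AEStronglyMeasurable h) {C : ℝ}
    (hb : ∀ u, ‖h u‖ ≤ C * Real.exp (-|u| / 2)) : Integrable h := by
  refine ((integrable_exp_neg_abs (a := 1 / 2) (by norm_num)).const_mul C).mono' hh
    (Eventually.of_forall fun u => (hb u).trans (le_of_eq ?_))
  ring_nf

theorem integrable_gR : Integrable gR := by
  obtain ⟨C, hC⟩ := exists_bound_gR
  exact integrable_of_norm_le_exp continuous_gR.aestronglyMeasurable fun u => (hC u).1

/-- Two integrable derivatives give quadratic decay of the transform. -/
theorem exists_norm_fourier_gR_le : ∃ K, ∀ w : ℝ, ‖𝓕 gR w‖ ≤ K / (1 + w ^ 2) := by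
  obtain ⟨C, hC⟩ := exists_bound_gR
  have hi1 : Integrable (deriv gR) := integrable_of_norm_le_exp
    (measurable_deriv gR).aestronglyMeasurable fun u => (hC u).2.1
  have hi2 : Integrable (deriv (deriv gR)) := integrable_of_norm_le_exp
    (measurable_deriv (deriv gR)).aestronglyMeasurable fun u => (hC u).2.2
  have e1 := Real.fourier_deriv integrable_gR (fun u => (hasDerivAt_gR u).differentiableAt) hi1
  have e2 := Real.fourier_deriv hi1 (fun u => (hasDerivAt_deriv_gR u).differentiableAt) hi2
  have hb : ∀ (h : ℝ → ℂ) (w : ℝ), ‖𝓕 h w‖ ≤ ∫ u, ‖h u‖ := fun h w =>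
    VectorFourier.norm_fourierIntegral_le_integral_norm _ _ _ _ _
  refine ⟨(∫ u, ‖gR u‖) + ∫ u, ‖deriv (deriv gR) u‖, fun w => ?_⟩
  rw [le_div_iff₀ (by positivity), mul_add, mul_one]
  refine add_le_add (hb _ _) (le_trans ?_ (hb (deriv (deriv gR)) w))
  rw [congrFun e2 w, congrFun e1 w, smul_eq_mul, smul_eq_mul, ← mul_assoc, norm_mul, mul_comm]
  gcongr
  have : ‖(2 * Real.pi * Complex.I * w * (2 * Real.pi * Complex.I * w) : ℂ)‖ =
      (2 * Real.pi) ^ 2 * w ^ 2 := by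
    simp only [norm_mul, Complex.norm_two, Complex.norm_real, Complex.norm_I, Real.norm_eq_abs,
      abs_of_pos Real.pi_pos]
    rw [← sq_abs w]
    ring
  rw [this]
  exact le_mul_of_one_le_left (sq_nonneg w) (by nlinarith [Real.pi_gt_three])

/-! ### Mellin transform of the tail of ψ and the completed zeta function -/

theorem continuousOn_psi : ContinuousOn psi (Ioi 0) := by
  have h : ContinuousOn (fun t => (HurwitzZeta.evenKernel 0 t - 1) / 2) (Ioi 0) :=
    ((HurwitzZeta.continuousOn_evenKernel 0).sub continuousOn_const).div_const 2
  refine h.congr fun t ht => ?_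
  simp only
  rw [evenKernel_zero_eq ht]
  ring

/-- The restriction of `ψ` to `(1, ∞)`. -/
def psiTail : ℝ → ℂ := (Ioi 1).indicator fun t => (psi t : ℂ)

/-- Cutting ψ off below 1 removes its singularity at 0, and the exponential decay at infinity beats
every power, so w is unrestricted. -/
theorem mellinConvergent_psiTail (w : ℂ) : MellinConvergent psiTail w := by
  refine mellinConvergent_of_isBigO_rpow (a := w.re + 1) (b := w.re - 1) ?_ ?_ (by linarith) ?_
    (by linarith)
  · have h : LocallyIntegrableOn (fun t => (psi t : ℂ)) (Ioi 0) :=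
      (Complex.continuous_ofReal.comp_continuousOn continuousOn_psi).locallyIntegrableOn
        measurableSet_Ioi
    intro x hx
    obtain ⟨s, hs, hs'⟩ := h x hx
    exact ⟨s, hs, hs'.indicator measurableSet_Ioi⟩
  · have h := (isLittleO_exp_neg_mul_rpow_atTop Real.pi_pos (-(w.re + 1))).isBigO
    refine Asymptotics.IsBigO.trans (Asymptotics.IsBigO.of_bound 2 ?_) h
    filter_upwards [eventually_gt_atTop 1] with t ht
    rw [psiTail, indicator_of_mem (mem_Ioi.2 ht), Complex.norm_real,
      Real.norm_of_nonneg (psi_nonneg t), Real.norm_of_nonneg (Real.exp_pos _).le]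
    exact psi_le ht.le
  · refine Asymptotics.IsBigO.of_bound 1 ?_
    filter_upwards [mem_nhdsWithin_of_mem_nhds (Iio_mem_nhds zero_lt_one)] with t ht
    have ht' : t < 1 := ht
    rw [psiTail, indicator_of_notMem (by simpa using ht'.le), norm_zero]
    positivity

/-- The modified kernel subtracts 1 from theta on (1, ∞) and t^{-1/2} on (0, 1). By the functional
equation, what remains on (0, 1) is the reflected tail; at t = 1 both sides vanish. -/
theorem f_modif_eq {t : ℝ} (ht : 0 < t) :
    (HurwitzZeta.hurwitzEvenFEPair 0).f_modif t =
      (2 : ℂ) • psiTail t + (2 : ℂ) • ((t : ℂ) ^ (-(1 / 2) : ℂ) • psiTail t⁻¹) := by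
  have e0 : ((t ^ (-(1 / 2) : ℝ) : ℝ) : ℂ) = (t : ℂ) ^ (-(1 / 2) : ℂ) := by
    rw [Complex.ofReal_cpow ht.le]; norm_num
  simp only [WeakFEPair.f_modif, HurwitzZeta.hurwitzEvenFEPair, psiTail, Pi.add_apply,
    Function.comp]
  rcases lt_trichotomy t 1 with h | rfl | h
  · have h' : 1 < t⁻¹ := (one_lt_inv₀ ht).2 h
    rw [indicator_of_notMem (by simpa using h.le), indicator_of_mem (mem_Ioo.2 ⟨ht, h⟩),
      indicator_of_notMem (by simpa using h.le), indicator_of_mem (mem_Ioi.2 h'),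
      evenKernel_zero_eq ht, psi_functional_equation ht, ← e0, one_div, ← Real.rpow_neg ht.le,
      one_div t]
    simp only [smul_eq_mul]
    push_cast
    ring
  · simp
  · have h' : ¬ 1 < t⁻¹ := not_lt.2 (inv_le_one_of_one_le₀ h.le)
    rw [indicator_of_mem (mem_Ioi.2 h), indicator_of_notMem (fun hh => absurd hh.2 h.not_gt),
      indicator_of_mem (mem_Ioi.2 h), indicator_of_notMem (mt mem_Ioi.1 h'), evenKernel_zero_eq ht]
    simp

/-- Riemann's symmetric integral representation of the completed zeta function. -/
theorem completedRiemannZeta₀_eq (s : ℂ) :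
    completedRiemannZeta₀ s = mellin psiTail (s / 2) + mellin psiTail ((1 - s) / 2) := by
  have h1 : completedRiemannZeta₀ s =
      mellin (HurwitzZeta.hurwitzEvenFEPair 0).f_modif (s / 2) / 2 := rfl
  have h2 : mellin (HurwitzZeta.hurwitzEvenFEPair 0).f_modif (s / 2) =
      mellin (fun t => (2 : ℂ) • psiTail t +
        (2 : ℂ) • ((t : ℂ) ^ (-(1 / 2) : ℂ) • psiTail t⁻¹)) (s / 2) := by
    refine setIntegral_congr_fun measurableSet_Ioi fun t ht => ?_
    simp only [f_modif_eq ht]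
  have hc : MellinConvergent (fun t : ℝ => (t : ℂ) ^ (-(1 / 2) : ℂ) • psiTail t⁻¹) (s / 2) := by
    rw [MellinConvergent.cpow_smul]
    have := (MellinConvergent.comp_rpow (f := psiTail) (s := s / 2 + -(1 / 2)) (a := -1)
      (by norm_num)).2 (mellinConvergent_psiTail _)
    simpa only [Real.rpow_neg_one] using this
  rw [h1, h2, (hasMellin_add ((mellinConvergent_psiTail _).const_smul _) (hc.const_smul _)).2,
    mellin_const_smul, mellin_const_smul, mellin_cpow_smul, mellin_comp_inv, smul_eq_mul,
    smul_eq_mul, show -(s / 2 + -(1 / 2)) = (1 - s) / 2 by ring]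
  ring

theorem completedRiemannZeta_eq_mellin (s : ℂ) :
    completedRiemannZeta s =
      mellin psiTail (s / 2) + mellin psiTail ((1 - s) / 2) - 1 / s - 1 / (1 - s) := by
  rw [completedRiemannZeta_eq, completedRiemannZeta₀_eq]

theorem xi_eq {s : ℂ} (hs : 0 < s.re) : xi s = 1 / 2 * s * (s - 1) * completedRiemannZeta s := by
  have hs0 : s ≠ 0 := by rintro rfl; simp at hs
  have hG := Complex.Gammaℝ_ne_zero_of_re_pos hs
  have hz := riemannZeta_def_of_ne_zero hs0
  rw [eq_div_iff hG, Complex.Gammaℝ_def] at hz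
  rw [xi, ← hz]
  ring

/-- At s = 1/2 + it the factor s(s - 1) equals -(t² + 1/4) and cancels the denominator. -/
theorem f_eq (t : ℝ) : f t = -(1 / 2) * completedRiemannZeta (1 / 2 + Complex.I * t) := by
  have h0 : ((t : ℂ) ^ 2 + 1 / 4) ≠ 0 := by
    have : ((t : ℂ) ^ 2 + 1 / 4) = ((t ^ 2 + 1 / 4 : ℝ) : ℂ) := by push_cast; ring
    rw [this]
    exact Complex.ofReal_ne_zero.2 (by positivity)
  rw [f, Xi, xi_eq (by simp), div_eq_iff h0]
  linear_combination (1 / 2 * t ^ 2 * completedRiemannZeta (1 / 2 + Complex.I * t)) * Complex.I_sq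

/-! ### Laplace and Fourier transforms of g, by t = e^{2u} -/

theorem image_exp_two_mul : (fun u : ℝ => Real.exp (2 * u)) '' Ioi 0 = Ioi 1 := by
  ext t
  constructor
  · rintro ⟨u, hu, rfl⟩
    have hu' : 0 < u := hu
    exact Real.one_lt_exp_iff.2 (by linarith)
  · intro ht
    have ht' : 1 < t := ht
    refine ⟨Real.log t / 2, div_pos (Real.log_pos ht') two_pos, ?_⟩
    simp only
    rw [mul_div_cancel₀ _ two_ne_zero, Real.exp_log (by linarith)]

theorem mellin_psiTail_eq (w : ℂ) :
    mellin psiTail w = ∫ t in Ioi (1 : ℝ), (t : ℂ) ^ (w - 1) * (psi t : ℂ) := by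
  have h : (fun t : ℝ => (t : ℂ) ^ (w - 1) • psiTail t) =
      (Ioi 1).indicator fun t : ℝ => (t : ℂ) ^ (w - 1) * (psi t : ℂ) := by
    funext t
    by_cases ht : t ∈ Ioi (1 : ℝ)
    · simp [psiTail, ht]
    · simp [psiTail, ht]
  rw [mellin, h, setIntegral_indicator measurableSet_Ioi, Ioi_inter_Ioi]
  norm_num

theorem integrableOn_cpow_mul_psi (w : ℂ) :
    IntegrableOn (fun t : ℝ => (t : ℂ) ^ (w - 1) * (psi t : ℂ)) (Ioi 1) := by
  have h : IntegrableOn (fun t : ℝ => (t : ℂ) ^ (w - 1) • psiTail t) (Ioi 0) :=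
    mellinConvergent_psiTail w
  refine (h.mono_set (Ioi_subset_Ioi zero_le_one)).congr_fun (fun t ht => ?_) measurableSet_Ioi
  simp only [psiTail, indicator_of_mem ht, smul_eq_mul]

theorem hasDerivAt_exp_two_mul (u : ℝ) :
    HasDerivAt (fun u : ℝ => Real.exp (2 * u)) (2 * Real.exp (2 * u)) u := by
  have := ((hasDerivAt_id u).const_mul 2).exp
  simpa [mul_comm] using this

theorem injective_exp_two_mul : Function.Injective fun u : ℝ => Real.exp (2 * u) := by
  intro a b hab
  have := Real.exp_injective hab
  linarith

theorem abs_smul_exp_two_mul (a : ℂ) (u : ℝ) :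
    |2 * Real.exp (2 * u)| • (((Real.exp (2 * u) : ℝ) : ℂ) ^ ((1 / 2 + a) / 2 - 1) *
      (psi (Real.exp (2 * u)) : ℂ)) =
    2 * (Complex.exp (u / 2) * (psi (Real.exp (2 * u)) : ℂ) * Complex.exp (a * u)) := by
  have h : ((Real.exp (2 * u) : ℝ) : ℂ) ^ ((1 / 2 + a) / 2 - 1) =
      Complex.exp (2 * u * ((1 / 2 + a) / 2 - 1)) := by
    rw [Complex.cpow_def_of_ne_zero (Complex.ofReal_ne_zero.2 (Real.exp_pos _).ne'),
      ← Complex.ofReal_log (Real.exp_pos _).le, Real.log_exp]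
    push_cast
    rfl
  rw [abs_of_pos (by positivity), Complex.real_smul, h]
  push_cast
  have e : Complex.exp (2 * u) * Complex.exp (2 * u * ((1 / 2 + a) / 2 - 1)) =
      Complex.exp (u / 2) * Complex.exp (a * u) := by
    rw [← Complex.exp_add, ← Complex.exp_add]
    ring_nf
  linear_combination 2 * (psi (Real.exp (2 * u)) : ℂ) * e

theorem integrableOn_psi_exp (a : ℂ) :
    IntegrableOn (fun u : ℝ => Complex.exp (u / 2) * (psi (Real.exp (2 * u)) : ℂ) *
      Complex.exp (a * u)) (Ioi 0) := by
  have h := integrableOn_cpow_mul_psi ((1 / 2 + a) / 2)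
  rw [← image_exp_two_mul, integrableOn_image_iff_integrableOn_abs_deriv_smul measurableSet_Ioi
    (fun u _ => (hasDerivAt_exp_two_mul u).hasDerivWithinAt) injective_exp_two_mul.injOn] at h
  simp_rw [abs_smul_exp_two_mul] at h
  have h2 := h.const_mul (1 / 2)
  refine h2.congr (Eventually.of_forall fun u => ?_)
  simp only
  ring

theorem integral_psi_exp (a : ℂ) :
    ∫ u in Ioi (0 : ℝ), Complex.exp (u / 2) * (psi (Real.exp (2 * u)) : ℂ) *
      Complex.exp (a * u) = 1 / 2 * mellin psiTail ((1 / 2 + a) / 2) := by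
  rw [mellin_psiTail_eq, ← image_exp_two_mul,
    integral_image_eq_integral_abs_deriv_smul measurableSet_Ioi
    (fun u _ => (hasDerivAt_exp_two_mul u).hasDerivWithinAt) injective_exp_two_mul.injOn]
  simp_rw [abs_smul_exp_two_mul]
  rw [integral_const_mul]
  ring

theorem gR_mul_exp (a : ℂ) (u : ℝ) :
    gR u * Complex.exp (a * u) = 1 / 2 * Complex.exp ((a - 1 / 2) * u) -
      Complex.exp (u / 2) * (psi (Real.exp (2 * u)) : ℂ) * Complex.exp (a * u) := by
  have e : Complex.exp ((a - 1 / 2) * u) = Complex.exp (-u / 2) * Complex.exp (a * u) := by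
    rw [← Complex.exp_add]; ring_nf
  rw [e, gR, gfun]
  push_cast
  ring

/-- The Laplace transform of `gfun` on the half-line. -/
theorem integral_gR_mul_exp {a : ℂ} (ha : a.re < 1 / 2) :
    ∫ u in Ioi (0 : ℝ), gR u * Complex.exp (a * u) =
      1 / 2 * (1 / (1 / 2 - a) - mellin psiTail ((1 / 2 + a) / 2)) := by
  have hre : (a - 1 / 2).re < 0 := by
    have : (1 / 2 : ℂ).re = 1 / 2 := by norm_num
    rw [Complex.sub_re, this]
    linarith
  have hne : (1 / 2 - a) ≠ 0 := by
    intro h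
    have h2 : a - 1 / 2 = 0 := by linear_combination -h
    rw [h2] at hre
    simp at hre
  simp_rw [gR_mul_exp]
  rw [integral_sub ((integrableOn_exp_mul_complex_Ioi hre 0).const_mul _) (integrableOn_psi_exp a),
    integral_psi_exp, integral_const_mul, integral_exp_mul_complex_Ioi hre]
  have hne' : a - 1 / 2 ≠ 0 := by
    intro h; exact hne (by linear_combination -h)
  have e : -Complex.exp ((a - 1 / 2) * ((0 : ℝ) : ℂ)) / (a - 1 / 2) = 1 / (1 / 2 - a) := by
    simp only [Complex.ofReal_zero, mul_zero, Complex.exp_zero]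
    rw [div_eq_div_iff hne' hne]
    ring
  rw [e]
  ring

theorem integral_eq_integral_Ioi_add {h : ℝ → ℂ} (hh : Integrable h) :
    ∫ u, h u = (∫ u in Ioi 0, h u) + ∫ u in Ioi 0, h (-u) := by
  rw [integral_comp_neg_Ioi, neg_zero, add_comm, ← compl_Ioi, add_comm]
  exact (integral_add_compl measurableSet_Ioi hh).symm

theorem integrable_gR_mul_exp_I (t : ℝ) :
    Integrable fun u : ℝ => gR u * Complex.exp (Complex.I * t * u) := by
  refine integrable_gR.mul_bdd (c := 1) (by fun_prop) (Eventually.of_forall fun u => ?_)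
  rw [Complex.norm_exp]
  simp

/-- Evenness folds the integral into the Laplace transforms at it and -it; these supply the two
Mellin terms and the two polar terms of the completed zeta function. -/
theorem f_eq_integral (t : ℝ) : f t = ∫ u, gR u * Complex.exp (Complex.I * t * u) := by
  rw [integral_eq_integral_Ioi_add (integrable_gR_mul_exp_I t)]
  have h1 := integral_gR_mul_exp (a := Complex.I * t) (by simp)
  have h2 := integral_gR_mul_exp (a := -(Complex.I * t)) (by simp)
  have e : ∀ u : ℝ, gR (-u) * Complex.exp (Complex.I * t * ((-u : ℝ) : ℂ)) =
      gR u * Complex.exp (-(Complex.I * t) * u) := by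
    intro u
    rw [gR_neg]
    push_cast
    ring_nf
  simp_rw [e]
  rw [h1, h2, f_eq, completedRiemannZeta_eq_mellin]
  have e2 : (1 - (1 / 2 + Complex.I * (t : ℂ))) = 1 / 2 - Complex.I * t := by ring
  have e3 : (1 / 2 + -(Complex.I * (t : ℂ))) = 1 / 2 - Complex.I * t := by ring
  rw [e2, e3, sub_neg_eq_add]
  ring

/-! ### The incomplete gamma series -/

/-- `gammaTerm` as a Mellin-type integral over `(1, ∞)`. -/
theorem gammaTerm_eq (s : ℝ) {n : ℕ} (hn : 0 < n) :
    gammaTerm s n = Real.pi ^ (s / 2) *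
      ∫ t in Ioi (1 : ℝ), t ^ (s / 2 - 1) * Real.exp (-Real.pi * (n : ℝ) ^ 2 * t) := by
  have hn' : (0 : ℝ) < n := Nat.cast_pos.2 hn
  have hb : 0 < Real.pi * (n : ℝ) ^ 2 := by positivity
  have h := integral_comp_mul_left_Ioi (fun t : ℝ => t ^ (s / 2 - 1) * Real.exp (-t)) 1 hb
  rw [mul_one, smul_eq_mul] at h
  have h2 : ∫ t in Ioi (1 : ℝ), (Real.pi * (n : ℝ) ^ 2 * t) ^ (s / 2 - 1) *
      Real.exp (-(Real.pi * (n : ℝ) ^ 2 * t)) = (Real.pi * (n : ℝ) ^ 2) ^ (s / 2 - 1) *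
      ∫ t in Ioi (1 : ℝ), t ^ (s / 2 - 1) * Real.exp (-Real.pi * (n : ℝ) ^ 2 * t) := by
    rw [← integral_const_mul]
    refine setIntegral_congr_fun measurableSet_Ioi fun t ht => ?_
    have ht' : (0 : ℝ) < t := zero_lt_one.trans ht
    rw [Real.mul_rpow hb.le ht'.le]
    ring_nf
  rw [h2] at h
  have h3 : upperGamma (s / 2) (Real.pi * (n : ℝ) ^ 2) = (Real.pi * (n : ℝ) ^ 2) ^ (s / 2) *
      ∫ t in Ioi (1 : ℝ), t ^ (s / 2 - 1) * Real.exp (-Real.pi * (n : ℝ) ^ 2 * t) := by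
    rw [upperGamma, ← mul_inv_cancel_left₀ hb.ne' (∫ t in Ioi (Real.pi * (n : ℝ) ^ 2), _), ← h,
      ← mul_assoc, Real.rpow_sub_one hb.ne']
    field_simp
  rw [gammaTerm, h3, Real.mul_rpow Real.pi_pos.le (by positivity), ← Real.rpow_natCast,
    ← Real.rpow_mul hn'.le, ← mul_assoc]
  congr 1
  have e : (n : ℝ) ^ (-s) * (n : ℝ) ^ (((2 : ℕ) : ℝ) * (s / 2)) = 1 := by
    rw [← Real.rpow_add hn']
    push_cast
    ring_nf
    exact Real.rpow_zero _
  linear_combination Real.pi ^ (s / 2) * e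

theorem integrableOn_rpow_mul_exp_neg (c : ℝ) :
    IntegrableOn (fun t : ℝ => t ^ c * Real.exp (-t)) (Ioi 1) := by
  refine integrable_of_isBigO_exp_neg (b := 1 / 2) (by norm_num) ?_ ?_
  · refine ContinuousOn.mul (fun t ht => ?_) (by fun_prop)
    have ht' : (1 : ℝ) ≤ t := ht
    exact (Real.continuousAt_rpow_const t c (Or.inl (by linarith))).continuousWithinAt
  · have := (Real.Gamma_integrand_isLittleO c).isBigO
    simpa only [mul_comm (Real.exp _)] using this

/-- Termwise integration of ψ on (1, ∞), justified by the majorant e^{-n} t^{s/2-1} e^{-t}, which is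
summable in n and integrable in t for every real s. -/
theorem hasSum_gammaTerm (s : ℝ) :
    HasSum (fun n : ℕ => gammaTerm s (n + 1))
      (Real.pi ^ (s / 2) * ∫ t in Ioi (1 : ℝ), t ^ (s / 2 - 1) * psi t) := by
  have hle : ∀ (n : ℕ) (t : ℝ), 1 < t →
      t ^ (s / 2 - 1) * Real.exp (-Real.pi * ((n : ℝ) + 1) ^ 2 * t) ≤
        Real.exp (-(n : ℝ)) * (t ^ (s / 2 - 1) * Real.exp (-t)) := by
    intro n t ht
    have ht0 : 0 < t := by linarith
    rw [mul_left_comm, ← Real.exp_add]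
    gcongr
    have hn : (0 : ℝ) ≤ n := n.cast_nonneg
    have h1 : (n : ℝ) + t ≤ ((n : ℝ) + 1) ^ 2 * t := by
      nlinarith [mul_nonneg hn (sub_nonneg.2 ht.le), mul_nonneg (sq_nonneg (n : ℝ)) ht0.le]
    have h2 : ((n : ℝ) + 1) ^ 2 * t ≤ Real.pi * (((n : ℝ) + 1) ^ 2 * t) :=
      le_mul_of_one_le_left (by positivity) (by linarith [Real.pi_gt_three])
    linarith
  have hint : ∀ n : ℕ, IntegrableOn
      (fun t : ℝ => t ^ (s / 2 - 1) * Real.exp (-Real.pi * ((n : ℝ) + 1) ^ 2 * t)) (Ioi 1) := by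
    intro n
    refine ((integrableOn_rpow_mul_exp_neg (s / 2 - 1)).const_mul (Real.exp (-(n : ℝ)))).mono'
      ?_ ?_
    · refine ContinuousOn.aestronglyMeasurable ?_ measurableSet_Ioi
      refine ContinuousOn.mul (fun t ht => ?_) (by fun_prop)
      have ht' : (1 : ℝ) < t := ht
      exact (Real.continuousAt_rpow_const t _ (Or.inl (by linarith))).continuousWithinAt
    · refine (ae_restrict_iff' measurableSet_Ioi).2 (Eventually.of_forall fun t ht => ?_)
      have ht0 : (0 : ℝ) < t := zero_lt_one.trans ht
      rw [Real.norm_of_nonneg (by positivity)]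
      exact hle n t ht
  have hsum := hasSum_integral_of_summable_integral_norm hint ?_
  · have hpsi : ∫ t in Ioi (1 : ℝ), ∑' n : ℕ,
        t ^ (s / 2 - 1) * Real.exp (-Real.pi * ((n : ℝ) + 1) ^ 2 * t) =
        ∫ t in Ioi (1 : ℝ), t ^ (s / 2 - 1) * psi t := by
      refine setIntegral_congr_fun measurableSet_Ioi fun t ht => ?_
      rw [tsum_mul_left, psi]
    rw [hpsi] at hsum
    refine (hsum.mul_left (Real.pi ^ (s / 2))).congr_fun fun n => ?_
    rw [gammaTerm_eq s n.succ_pos]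
    push_cast
    rfl
  · have hexp : Summable fun n : ℕ => Real.exp (-(n : ℝ)) *
        ∫ t in Ioi (1 : ℝ), t ^ (s / 2 - 1) * Real.exp (-t) :=
      Real.summable_exp_neg_nat.mul_right _
    refine Summable.of_nonneg_of_le (fun n => integral_nonneg fun _ => norm_nonneg _)
      (fun n => ?_) hexp
    rw [← integral_const_mul]
    refine setIntegral_mono_on (hint n).norm
      ((integrableOn_rpow_mul_exp_neg (s / 2 - 1)).const_mul _) measurableSet_Ioi fun t ht => ?_
    have ht0 : (0 : ℝ) < t := zero_lt_one.trans ht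
    rw [Real.norm_of_nonneg (by positivity)]
    exact hle n t ht

theorem mellin_psiTail_ofReal (s : ℝ) :
    mellin psiTail ((s : ℂ) / 2) =
      ((Real.pi ^ (-s / 2) * ∑' n : ℕ, gammaTerm s (n + 1) : ℝ) : ℂ) := by
  have h : ∫ t in Ioi (1 : ℝ), (t : ℂ) ^ ((s : ℂ) / 2 - 1) * (psi t : ℂ) =
      ∫ t in Ioi (1 : ℝ), ((t ^ (s / 2 - 1) * psi t : ℝ) : ℂ) := by
    refine setIntegral_congr_fun measurableSet_Ioi fun t ht => ?_
    have ht0 : (0 : ℝ) ≤ t := zero_le_one.trans (le_of_lt ht)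
    push_cast
    rw [Complex.ofReal_cpow ht0]
    push_cast
    rfl
  rw [(hasSum_gammaTerm s).tsum_eq, mellin_psiTail_eq, h, integral_complex_ofReal, ← mul_assoc,
    ← Real.rpow_add Real.pi_pos]
  ring_nf
  simp

/-! ### The Poisson kernel and the harmonic extension -/

theorem integrable_div_sq_add_sq {y : ℝ} (hy : 0 < y) :
    Integrable fun t : ℝ => y / (y ^ 2 + t ^ 2) := by
  refine ((integrable_inv_one_add_sq.comp_div hy.ne').const_mul (1 / y)).congr
    (Eventually.of_forall fun t => ?_)
  have : y ^ 2 + t ^ 2 ≠ 0 := by positivity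
  simp only
  field_simp

theorem norm_exp_I_mul (t u : ℝ) : ‖Complex.exp (Complex.I * t * u)‖ = 1 := by
  rw [Complex.norm_exp]
  simp

theorem integral_exp_neg_abs_mul_exp {y : ℝ} (hy : 0 < y) (t : ℝ) :
    ∫ u : ℝ, ((Real.exp (-(y * |u|)) : ℝ) : ℂ) * Complex.exp (Complex.I * t * u) =
      2 * ((y / (y ^ 2 + t ^ 2) : ℝ) : ℂ) := by
  have hi : Integrable fun u : ℝ =>
      ((Real.exp (-(y * |u|)) : ℝ) : ℂ) * Complex.exp (Complex.I * t * u) :=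
    (integrable_exp_neg_abs hy).ofReal.mul_bdd (c := 1) (by fun_prop)
      (Eventually.of_forall fun u => (norm_exp_I_mul t u).le)
  have r1 : (-(y : ℂ) + Complex.I * t).re < 0 := by simpa using hy
  have r2 : (-(y : ℂ) - Complex.I * t).re < 0 := by simpa using hy
  have n1 : (-(y : ℂ) + Complex.I * t) ≠ 0 := fun h => by rw [h] at r1; simp at r1
  have n2 : (-(y : ℂ) - Complex.I * t) ≠ 0 := fun h => by rw [h] at r2; simp at r2
  have h1 : ∫ u in Ioi (0 : ℝ), ((Real.exp (-(y * |u|)) : ℝ) : ℂ) *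
      Complex.exp (Complex.I * t * u) = -1 / (-(y : ℂ) + Complex.I * t) := by
    have := integral_exp_mul_complex_Ioi r1 0
    rw [Complex.ofReal_zero, mul_zero, Complex.exp_zero] at this
    rw [← this]
    refine setIntegral_congr_fun measurableSet_Ioi fun u hu => ?_
    have hu' : 0 < u := hu
    simp only [abs_of_pos hu']
    push_cast
    rw [← Complex.exp_add]
    ring_nf
  have h2 : ∫ u in Ioi (0 : ℝ), ((Real.exp (-(y * |-u|)) : ℝ) : ℂ) *
      Complex.exp (Complex.I * t * ((-u : ℝ) : ℂ)) = -1 / (-(y : ℂ) - Complex.I * t) := by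
    have := integral_exp_mul_complex_Ioi r2 0
    rw [Complex.ofReal_zero, mul_zero, Complex.exp_zero] at this
    rw [← this]
    refine setIntegral_congr_fun measurableSet_Ioi fun u hu => ?_
    have hu' : 0 < u := hu
    simp only [abs_neg, abs_of_pos hu']
    push_cast
    rw [← Complex.exp_add]
    ring_nf
  have n3 : ((y : ℂ) ^ 2 + (t : ℂ) ^ 2) ≠ 0 := by
    have : ((y : ℂ) ^ 2 + (t : ℂ) ^ 2) = ((y ^ 2 + t ^ 2 : ℝ) : ℂ) := by push_cast; ring
    rw [this]
    exact Complex.ofReal_ne_zero.2 (by positivity)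
  rw [integral_eq_integral_Ioi_add hi, h1, h2]
  push_cast
  rw [div_add_div _ _ n1 n2, mul_div_assoc', div_eq_div_iff (mul_ne_zero n1 n2) n3]
  linear_combination (2 * (y : ℂ) * t ^ 2) * Complex.I_sq

theorem fourier_eq_integral (h : ℝ → ℂ) (w : ℝ) :
    𝓕 h w = ∫ u, h u * Complex.exp (Complex.I * ((-(2 * Real.pi * w) : ℝ) : ℂ) * u) := by
  rw [Real.fourier_real_eq_integral_exp_smul]
  refine integral_congr_ae (Eventually.of_forall fun u => ?_)
  simp only [smul_eq_mul]
  rw [mul_comm]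
  push_cast
  ring_nf

/-- The Fourier transform of the Poisson kernel of the upper half-plane. -/
theorem integral_poissonKernel_mul_exp {y : ℝ} (hy : 0 < y) (u : ℝ) :
    ∫ t : ℝ, ((y / (y ^ 2 + t ^ 2) : ℝ) : ℂ) * Complex.exp (Complex.I * t * u) =
      Real.pi * ((Real.exp (-(y * |u|)) : ℝ) : ℂ) := by
  set e : ℝ → ℂ := fun u => ((Real.exp (-(y * |u|)) : ℝ) : ℂ) with he
  have hF : 𝓕 e = fun w : ℝ => 2 * ((y / (y ^ 2 + (2 * Real.pi * w) ^ 2) : ℝ) : ℂ) := by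
    funext w
    rw [fourier_eq_integral, integral_exp_neg_abs_mul_exp hy, neg_sq]
  have h2pi : (2 * Real.pi) ≠ 0 := by positivity
  have hFi : Integrable (𝓕 e) := by
    rw [hF]
    exact (((integrable_div_sq_add_sq hy).comp_mul_left' h2pi).ofReal).const_mul 2
  have hcont : Continuous e := by fun_prop
  -- The kernel is, up to scaling, the transform of e^{-y|u|}, which is elementary to compute;
  -- inversion then gives the transform of the kernel.
  have hinv := hcont.fourierInv_fourier_eq (integrable_exp_neg_abs hy).ofReal hFi
  have hu := congrFun hinv u
  rw [Real.fourierInv_eq_fourier_neg, fourier_eq_integral, hF] at hu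
  have hsub := Measure.integral_comp_mul_left
    (fun t : ℝ => ((y / (y ^ 2 + t ^ 2) : ℝ) : ℂ) * Complex.exp (Complex.I * t * u)) (2 * Real.pi)
  have e1 : ∀ w : ℝ, 2 * ((y / (y ^ 2 + (2 * Real.pi * w) ^ 2) : ℝ) : ℂ) *
      Complex.exp (Complex.I * ((-(2 * Real.pi * -u) : ℝ) : ℂ) * w) =
      2 * (((y / (y ^ 2 + (2 * Real.pi * w) ^ 2) : ℝ) : ℂ) *
      Complex.exp (Complex.I * ((2 * Real.pi * w : ℝ) : ℂ) * u)) := by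
    intro w
    rw [mul_assoc]
    congr 3
    push_cast
    ring
  simp_rw [e1] at hu
  rw [integral_const_mul, hsub, abs_of_pos (by positivity), Complex.real_smul] at hu
  have hu' : ((Real.exp (-(y * |u|)) : ℝ) : ℂ) = e u := rfl
  rw [hu', ← hu]
  have : (Real.pi : ℂ) ≠ 0 := Complex.ofReal_ne_zero.2 Real.pi_ne_zero
  generalize (∫ t : ℝ, ((y / (y ^ 2 + t ^ 2) : ℝ) : ℂ) * Complex.exp (Complex.I * t * u)) = A
  push_cast
  field_simp

theorem integrable_poissonKernel {y : ℝ} (hy : 0 < y) (x : ℝ) :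
    Integrable fun t : ℝ => y / (y ^ 2 + (x - t) ^ 2) :=
  (integrable_div_sq_add_sq hy).comp_sub_left x

theorem integral_poissonKernel_sub_mul_exp {y : ℝ} (hy : 0 < y) (x u : ℝ) :
    ∫ t : ℝ, ((y / (y ^ 2 + (x - t) ^ 2) : ℝ) : ℂ) * Complex.exp (Complex.I * t * u) =
      Real.pi * (((Real.exp (-(y * |u|)) : ℝ) : ℂ) * Complex.exp (Complex.I * x * u)) := by
  rw [← integral_add_right_eq_self _ x, ← mul_assoc, ← integral_poissonKernel_mul_exp hy,
    ← integral_mul_const]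
  refine integral_congr_ae (Eventually.of_forall fun t => ?_)
  simp only
  rw [mul_assoc _ (Complex.exp _), ← Complex.exp_add]
  push_cast
  ring_nf

/-- The harmonic extension of `f`, as a Fourier integral. -/
def FC (x y : ℝ) : ℂ :=
  ∫ u : ℝ, gR u * ((Real.exp (-(y * |u|)) : ℝ) : ℂ) * Complex.exp (Complex.I * x * u)

theorem f_eq_fourier (t : ℝ) : f t = 𝓕 gR (-(t / (2 * Real.pi))) := by
  rw [fourier_eq_integral, f_eq_integral]
  have : -(2 * Real.pi * -(t / (2 * Real.pi))) = t := by
    field_simp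
  rw [this]

theorem continuous_f : Continuous f := by
  have h : Continuous (𝓕 gR) := VectorFourier.fourierIntegral_continuous
    Real.continuous_fourierChar (by exact continuous_inner) integrable_gR
  have h2 : f = fun t => 𝓕 gR (-(t / (2 * Real.pi))) := funext f_eq_fourier
  rw [h2]
  fun_prop

theorem exists_norm_f_le : ∃ K, 0 ≤ K ∧ ∀ t : ℝ, ‖f t‖ ≤ K / (1 + t ^ 2) := by
  obtain ⟨K, hK⟩ := exists_norm_fourier_gR_le
  have hK0 : 0 ≤ K := by
    have := (norm_nonneg _).trans (hK 0)
    simpa using this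
  refine ⟨K * (2 * Real.pi) ^ 2, by positivity, fun t => ?_⟩
  rw [f_eq_fourier]
  refine (hK _).trans ?_
  rw [neg_sq, div_pow, div_le_div_iff₀ (by positivity) (by positivity), mul_assoc]
  refine mul_le_mul_of_nonneg_left ?_ hK0
  rw [mul_add, mul_div_cancel₀ _ (by positivity)]
  nlinarith [Real.pi_gt_three]

theorem integrable_poissonIntegrand_f (x : ℝ) {y : ℝ} (hy : 0 < y) :
    Integrable (poissonIntegrand f x y) := by
  obtain ⟨K, hK0, hK⟩ := exists_norm_f_le
  refine (integrable_poissonKernel hy x).ofReal.mul_bdd (c := K) continuous_f.aestronglyMeasurable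
    (Eventually.of_forall fun t => (hK t).trans (div_le_self hK0 ?_))
  nlinarith [sq_nonneg t]

/-- Fubini: integrating the Poisson kernel against e^{itu} first yields π e^{-y|u|} e^{ixu}. -/
theorem harmonicContinuation_f (x : ℝ) {y : ℝ} (hy : 0 < y) :
    harmonicContinuation f x y = FC x y := by
  have hpi : (Real.pi : ℂ) ≠ 0 := Complex.ofReal_ne_zero.2 Real.pi_ne_zero
  have hprod : Integrable (Function.uncurry fun t u : ℝ =>
      ((y / (y ^ 2 + (x - t) ^ 2) : ℝ) : ℂ) * gR u * Complex.exp (Complex.I * t * u))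
      (volume.prod volume) := by
    refine ((integrable_poissonKernel hy x).ofReal.mul_prod integrable_gR).mul_bdd (c := 1)
      (g := fun p : ℝ × ℝ => Complex.exp (Complex.I * p.1 * p.2)) ?_
      (Eventually.of_forall fun p => (norm_exp_I_mul p.1 p.2).le)
    exact Continuous.aestronglyMeasurable (by fun_prop)
  have h1 : ∫ t : ℝ, poissonIntegrand f x y t = ∫ t : ℝ, ∫ u : ℝ,
      ((y / (y ^ 2 + (x - t) ^ 2) : ℝ) : ℂ) * gR u * Complex.exp (Complex.I * t * u) := by
    refine integral_congr_ae (Eventually.of_forall fun t => ?_)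
    simp only [poissonIntegrand]
    rw [f_eq_integral, ← integral_const_mul]
    simp_rw [mul_assoc]
  rw [harmonicContinuation, h1, integral_integral_swap hprod, FC, ← integral_const_mul]
  refine integral_congr_ae (Eventually.of_forall fun u => ?_)
  simp only
  have h2 : ∀ t : ℝ, ((y / (y ^ 2 + (x - t) ^ 2) : ℝ) : ℂ) * gR u *
      Complex.exp (Complex.I * t * u) = gR u * (((y / (y ^ 2 + (x - t) ^ 2) : ℝ) : ℂ) *
      Complex.exp (Complex.I * t * u)) := fun t => by ring
  simp_rw [h2]
  rw [integral_const_mul, integral_poissonKernel_sub_mul_exp hy]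
  field_simp

/-- The decay needed on the dual side of Poisson summation. Since e^{-y|u|} is not differentiable at
0, the bound comes from the decay of `f` through the Poisson integral instead of from derivatives of
the damped function. -/
theorem exists_norm_FC_mul_sq_le {y : ℝ} (hy : 0 < y) :
    ∃ K, 0 ≤ K ∧ ∀ x : ℝ, ‖FC x y‖ * x ^ 2 ≤ K := by
  obtain ⟨K, hK0, hK⟩ := exists_norm_f_le
  refine ⟨1 / Real.pi * ∫ t : ℝ, (2 * K * (y / (y ^ 2 + t ^ 2)) + 2 * y * K * (1 + t ^ 2)⁻¹), ?_,
    fun x => ?_⟩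
  · refine mul_nonneg (by positivity) (integral_nonneg fun t => ?_)
    simp only [Pi.zero_apply]
    positivity
  have hi1 := integrable_div_sq_add_sq hy
  have hi2 := integrable_inv_one_add_sq
  have hi3 := integrable_poissonKernel hy x
  have e : ∫ t : ℝ, (2 * K * (y / (y ^ 2 + t ^ 2)) + 2 * y * K * (1 + t ^ 2)⁻¹) =
      ∫ t : ℝ, (2 * K * (y / (y ^ 2 + (x - t) ^ 2)) + 2 * y * K * (1 + t ^ 2)⁻¹) := by
    rw [integral_add (hi1.const_mul _) (hi2.const_mul _),
      integral_add (hi3.const_mul _) (hi2.const_mul _), integral_const_mul, integral_const_mul,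
      integral_const_mul, integral_sub_left_eq_self (fun t : ℝ => y / (y ^ 2 + t ^ 2)) volume x]
  rw [e, ← harmonicContinuation_f x hy, harmonicContinuation, norm_mul, mul_assoc]
  have hn : ‖(1 / (Real.pi : ℂ))‖ = 1 / Real.pi := by
    rw [norm_div, norm_one, Complex.norm_real, Real.norm_of_nonneg Real.pi_pos.le]
  rw [hn]
  refine mul_le_mul_of_nonneg_left ?_ (by positivity)
  refine (mul_le_mul_of_nonneg_right (norm_integral_le_integral_norm _) (sq_nonneg x)).trans ?_
  rw [← integral_mul_const]
  refine integral_mono ((integrable_poissonIntegrand_f x hy).norm.mul_const _)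
    ((hi3.const_mul _).add (hi2.const_mul _)) fun t => ?_
  simp only [poissonIntegrand]
  have hA : 0 < y ^ 2 + (x - t) ^ 2 := by positivity
  have hB : 0 < 1 + t ^ 2 := by positivity
  rw [norm_mul, Complex.norm_real, Real.norm_of_nonneg (by positivity)]
  -- The part t² is absorbed by the decay of `f`, the part (x - t)² by the Poisson kernel.
  have hx : x ^ 2 ≤ 2 * t ^ 2 + 2 * (x - t) ^ 2 := by nlinarith [sq_nonneg (x - 2 * t)]
  calc y / (y ^ 2 + (x - t) ^ 2) * ‖f t‖ * x ^ 2
      ≤ y / (y ^ 2 + (x - t) ^ 2) * (K / (1 + t ^ 2)) * (2 * t ^ 2 + 2 * (x - t) ^ 2) := by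
        gcongr
        exact hK t
    _ = 2 * K * (y / (y ^ 2 + (x - t) ^ 2)) * (t ^ 2 / (1 + t ^ 2)) +
        2 * y * K * (1 + t ^ 2)⁻¹ * ((x - t) ^ 2 / (y ^ 2 + (x - t) ^ 2)) := by
        field_simp
    _ ≤ 2 * K * (y / (y ^ 2 + (x - t) ^ 2)) * 1 + 2 * y * K * (1 + t ^ 2)⁻¹ * 1 := by
        gcongr
        · exact (div_le_one hB).2 (by linarith)
        · exact (div_le_one hA).2 (by nlinarith)
    _ = _ := by ring

theorem FC_neg (x y : ℝ) : FC (-x) y = FC x y := by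
  rw [FC, FC, ← integral_neg_eq_self]
  refine integral_congr_ae (Eventually.of_forall fun u => ?_)
  simp only [gR_neg, abs_neg]
  push_cast
  ring_nf

theorem conj_FC (x y : ℝ) : (starRingEnd ℂ) (FC x y) = FC x y := by
  rw [← FC_neg x y]
  nth_rw 2 [← FC_neg (-x) y]
  rw [FC, FC, ← integral_conj]
  refine integral_congr_ae (Eventually.of_forall fun u => ?_)
  simp only [map_mul, gR, Complex.conj_ofReal, ← Complex.exp_conj, Complex.conj_I]
  push_cast
  ring_nf

theorem ofReal_FC_re (x y : ℝ) : ((FC x y).re : ℂ) = FC x y :=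
  Complex.conj_eq_iff_re.1 (conj_FC x y)

/-- Since e^{-y|u|} ≤ 1 for y ≥ 0, |g| dominates uniformly, down to and including y = 0. Both limits
of the theorem are instances. -/
theorem tendsto_FC {ι : Type*} {l : Filter ι} [l.IsCountablyGenerated] {a b : ι → ℝ} {x y : ℝ}
    (ha : Tendsto a l (𝓝 x)) (hb : Tendsto b l (𝓝 y)) (hb0 : ∀ᶠ i in l, 0 ≤ b i) :
    Tendsto (fun i => FC (a i) (b i)) l (𝓝 (FC x y)) := by
  refine tendsto_integral_filter_of_dominated_convergence (fun u => ‖gR u‖) ?_ ?_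
    integrable_gR.norm ?_
  · refine Eventually.of_forall fun i => ?_
    have := continuous_gR
    exact Continuous.aestronglyMeasurable (by fun_prop)
  · filter_upwards [hb0] with i hi
    refine Eventually.of_forall fun u => ?_
    rw [norm_mul, norm_mul, norm_exp_I_mul, mul_one, Complex.norm_real,
      Real.norm_of_nonneg (Real.exp_pos _).le]
    refine mul_le_of_le_one_right (norm_nonneg _) (Real.exp_le_one_iff.2 ?_)
    have := mul_nonneg hi (abs_nonneg u)
    linarith
  · refine Eventually.of_forall fun u => ?_
    have h1 : Continuous fun y : ℝ => gR u * ((Real.exp (-(y * |u|)) : ℝ) : ℂ) := by fun_prop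
    have h2 : Continuous fun x : ℝ => Complex.exp (Complex.I * x * u) := by fun_prop
    exact ((h1.tendsto y).comp hb).mul ((h2.tendsto x).comp ha)

theorem FC_zero_right (x : ℝ) : FC x 0 = f x := by
  rw [f_eq_integral, FC]
  simp

theorem FC_zero_left {y : ℝ} (hy : 0 < y) :
    FC 0 y = 1 / (1 / 2 + (y : ℂ)) - mellin psiTail ((1 / 2 - y) / 2) := by
  have hi : Integrable fun u : ℝ => gR u * ((Real.exp (-(y * |u|)) : ℝ) : ℂ) := by
    refine integrable_gR.mul_bdd (c := 1)
      (Continuous.aestronglyMeasurable (by fun_prop)) (Eventually.of_forall fun u => ?_)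
    rw [Complex.norm_real, Real.norm_of_nonneg (Real.exp_pos _).le, Real.exp_le_one_iff]
    have := mul_nonneg hy.le (abs_nonneg u)
    linarith
  have h := integral_gR_mul_exp (a := -(y : ℂ)) (by simp; linarith)
  have e : ∫ u in Ioi (0 : ℝ), gR u * ((Real.exp (-(y * |u|)) : ℝ) : ℂ) =
      ∫ u in Ioi (0 : ℝ), gR u * Complex.exp (-(y : ℂ) * u) := by
    refine setIntegral_congr_fun measurableSet_Ioi fun u hu => ?_
    have hu' : 0 < u := hu
    simp only [abs_of_pos hu']
    push_cast
    ring_nf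
  have h0 : FC 0 y = ∫ u : ℝ, gR u * ((Real.exp (-(y * |u|)) : ℝ) : ℂ) := by
    rw [FC]
    simp
  rw [h0, integral_eq_integral_Ioi_add hi]
  simp_rw [gR_neg, abs_neg]
  rw [e, h, sub_neg_eq_add, ← sub_eq_add_neg]
  ring

/-! ### Poisson summation -/

/-- `gfun` times the Laplace factor `e^{-y|u|}`. -/
def damped (y u : ℝ) : ℝ := gfun u * Real.exp (-(y * |u|))

theorem damped_neg (y u : ℝ) : damped y (-u) = damped y u := by
  rw [damped, damped, gfun_neg, abs_neg]

theorem continuous_damped (y : ℝ) : Continuous (damped y) := by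
  have h : Continuous gfun := by
    have h' : gfun = Complex.re ∘ gR := funext fun u => (Complex.ofReal_re _).symm
    rw [h']
    exact Complex.continuous_re.comp continuous_gR
  unfold damped
  fun_prop

theorem FC_eq_integral_damped (x y : ℝ) :
    FC x y = ∫ u : ℝ, (damped y u : ℂ) * Complex.exp (Complex.I * x * u) := by
  rw [FC]
  refine integral_congr_ae (Eventually.of_forall fun u => ?_)
  simp only [gR, damped]
  push_cast
  rfl

/-- The decay is that of g itself, so y = 0 is allowed. -/
theorem isBigO_damped {y h : ℝ} (hy : 0 ≤ y) (hh : 0 < h) :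
    (fun v : ℝ => (damped y (h * v) : ℂ)) =O[cocompact ℝ] fun v : ℝ => |v| ^ (-2 : ℝ) := by
  obtain ⟨C, hC⟩ := exists_bound_gR
  have hC0 : 0 ≤ C := by
    have := (norm_nonneg _).trans (hC 0).1
    simpa using this
  refine Asymptotics.IsBigO.of_bound (C * (8 / h ^ 2)) ?_
  have h0 : ∀ᶠ v : ℝ in cocompact ℝ, v ≠ 0 :=
    (isCompact_singleton (x := (0 : ℝ))).compl_mem_cocompact
  filter_upwards [h0] with v hv
  have hv' : 0 < |v| := abs_pos.2 hv
  have e1 : ‖(|v| ^ (-2 : ℝ) : ℝ)‖ = 1 / v ^ 2 := by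
    rw [Real.norm_of_nonneg (by positivity), Real.rpow_neg hv'.le, one_div]
    norm_num
  have e2 : ‖(damped y (h * v) : ℂ)‖ ≤ ‖gR (h * v)‖ := by
    rw [damped, gR, Complex.norm_real, Complex.norm_real, norm_mul,
      Real.norm_of_nonneg (Real.exp_pos _).le]
    refine mul_le_of_le_one_right (norm_nonneg _) (Real.exp_le_one_iff.2 ?_)
    have := mul_nonneg hy (abs_nonneg (h * v))
    linarith
  rw [e1]
  refine (e2.trans (hC _).1).trans ?_
  rw [mul_assoc]
  refine mul_le_mul_of_nonneg_left ?_ hC0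
  have hz : 0 < |h * v| := abs_pos.2 (mul_ne_zero hh.ne' hv)
  -- The quadratic term of the exponential at |hv|/2 is (hv)²/8, the source of the constant 8/h².
  have hq := Real.quadratic_le_exp_of_nonneg (x := |h * v| / 2) (by positivity)
  have hs : |h * v| ^ 2 = h ^ 2 * v ^ 2 := by rw [sq_abs]; ring
  have hexp : h ^ 2 * v ^ 2 / 8 ≤ Real.exp (|h * v| / 2) := by nlinarith
  have hpos : 0 < h ^ 2 * v ^ 2 / 8 := by positivity
  rw [neg_div, Real.exp_neg]
  calc (Real.exp (|h * v| / 2))⁻¹ ≤ (h ^ 2 * v ^ 2 / 8)⁻¹ := inv_anti₀ hpos hexp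
    _ = 8 / h ^ 2 * (1 / v ^ 2) := by
      field_simp

theorem fourier_damped_comp_mul (y : ℝ) {h : ℝ} (hh : 0 < h) (w : ℝ) :
    𝓕 (fun v : ℝ => (damped y (h * v) : ℂ)) w = (1 / h : ℝ) * FC (2 * Real.pi / h * w) y := by
  have hsub := Measure.integral_comp_mul_left (fun u : ℝ => (damped y u : ℂ) *
    Complex.exp (Complex.I * ((-(2 * Real.pi / h * w) : ℝ) : ℂ) * u)) h
  rw [abs_of_pos (inv_pos.2 hh), Complex.real_smul, ← FC_eq_integral_damped, FC_neg] at hsub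
  rw [fourier_eq_integral, one_div, ← hsub]
  refine integral_congr_ae (Eventually.of_forall fun v => ?_)
  simp only
  have hc : (h : ℂ) ≠ 0 := Complex.ofReal_ne_zero.2 hh.ne'
  congr 2
  push_cast
  field_simp

theorem isBigO_FC {y c : ℝ} (hy : 0 < y) (hc : 0 < c) :
    (fun w : ℝ => FC (c * w) y) =O[cocompact ℝ] fun w : ℝ => |w| ^ (-2 : ℝ) := by
  obtain ⟨K, hK0, hK⟩ := exists_norm_FC_mul_sq_le hy
  refine Asymptotics.IsBigO.of_bound (K / c ^ 2) ?_
  have h0 : ∀ᶠ v : ℝ in cocompact ℝ, v ≠ 0 :=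
    (isCompact_singleton (x := (0 : ℝ))).compl_mem_cocompact
  filter_upwards [h0] with w hw
  have hw' : 0 < |w| := abs_pos.2 hw
  have e1 : ‖(|w| ^ (-2 : ℝ) : ℝ)‖ = 1 / w ^ 2 := by
    rw [Real.norm_of_nonneg (by positivity), Real.rpow_neg hw'.le, one_div]
    norm_num
  rw [e1, div_mul_div_comm, mul_one, le_div_iff₀ (by positivity), ← mul_pow]
  exact hK _

theorem summable_int_of_isBigO {φ : ℝ → ℂ}
    (h : φ =O[cocompact ℝ] fun v : ℝ => |v| ^ (-2 : ℝ)) : Summable fun n : ℤ => φ n :=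
  summable_of_isBigO (Real.summable_abs_int_rpow one_lt_two)
    (h.comp_tendsto Int.tendsto_coe_cofinite)

theorem hasSum_nat_of_even {φ : ℝ → ℂ} (hs : Summable fun n : ℤ => φ n)
    (he : ∀ v, φ (-v) = φ v) :
    HasSum (fun n : ℕ => φ ((n : ℝ) + 1)) ((∑' n : ℤ, φ n - φ 0) / 2) := by
  have h := hs.hasSum.nat_add_neg
  -- Pairing n with -n counts the origin twice; dropping index 0 leaves the total minus φ(0), to be
  -- halved.
  rw [← hasSum_nat_add_iff' 1] at h
  simp only [Finset.sum_range_one, Int.cast_neg, Int.cast_natCast, Nat.cast_zero,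
    Int.cast_zero, he, Int.cast_add, Int.cast_one, Nat.cast_add, Nat.cast_one] at h
  convert! h.div_const 2 using 1
  · funext n
    ring
  · ring

theorem summable_damped {y h : ℝ} (hy : 0 ≤ y) (hh : 0 < h) :
    Summable fun n : ℕ => damped y (h * ((n : ℝ) + 1)) := by
  have := (hasSum_nat_of_even (φ := fun v : ℝ => (damped y (h * v) : ℂ))
    (summable_int_of_isBigO (isBigO_damped hy hh))
    (fun v => by simp only [mul_neg, damped_neg])).summable
  exact Complex.summable_ofReal.1 this

theorem summable_FC_re {y c : ℝ} (hy : 0 < y) (hc : 0 < c) :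
    Summable fun n : ℕ => (FC (c * ((n : ℝ) + 1)) y).re := by
  have := (hasSum_nat_of_even (φ := fun v : ℝ => FC (c * v) y)
    (summable_int_of_isBigO (isBigO_FC hy hc))
    (fun v => by simp only [mul_neg, FC_neg])).summable
  exact (Complex.hasSum_re this.hasSum).summable

/-- Poisson summation for `damped`, as an identity between sums over the positive integers. -/
theorem poisson_summation_damped {y h : ℝ} (hy : 0 < y) (hh : 0 < h) :
    damped y 0 + 2 * ∑' n : ℕ, damped y (h * ((n : ℝ) + 1)) =
      1 / h * ((FC 0 y).re + 2 * ∑' k : ℕ, (FC (2 * Real.pi / h * ((k : ℝ) + 1)) y).re) := by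
  have hc : 0 < 2 * Real.pi / h := by positivity
  have hcont : Continuous fun v : ℝ => (damped y (h * v) : ℂ) := by
    have := continuous_damped y
    fun_prop
  have hF : 𝓕 (fun v : ℝ => (damped y (h * v) : ℂ)) =
      fun w : ℝ => ((1 / h : ℝ) : ℂ) * FC (2 * Real.pi / h * w) y :=
    funext fun w => fourier_damped_comp_mul y hh w
  have hP := Real.tsum_eq_tsum_fourier_of_rpow_decay hcont one_lt_two
    (isBigO_damped hy.le hh) (by rw [hF]; exact (isBigO_FC hy hc).const_mul_left _) 0
  rw [hF] at hP
  simp only [zero_add, QuotientAddGroup.mk_zero, fourier_eval_zero, mul_one] at hP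
  rw [tsum_mul_left] at hP
  have h1 := hasSum_nat_of_even (φ := fun v : ℝ => (damped y (h * v) : ℂ))
    (summable_int_of_isBigO (isBigO_damped hy.le hh))
    (fun v => by simp only [mul_neg, damped_neg])
  have h2 := hasSum_nat_of_even (φ := fun v : ℝ => FC (2 * Real.pi / h * v) y)
    (summable_int_of_isBigO (isBigO_FC hy hc))
    (fun v => by simp only [mul_neg, FC_neg])
  have t1 := h1.tsum_eq
  have t2 : ((∑' k : ℕ, (FC (2 * Real.pi / h * ((k : ℝ) + 1)) y).re : ℝ) : ℂ) =
      (∑' n : ℤ, FC (2 * Real.pi / h * n) y - FC (2 * Real.pi / h * 0) y) / 2 := by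
    rw [Complex.ofReal_tsum, ← h2.tsum_eq]
    exact tsum_congr fun k => ofReal_FC_re _ _
  rw [← Complex.ofReal_tsum] at t1
  simp only [mul_zero] at t1 t2
  rw [← Complex.ofReal_inj]
  simp only [Complex.ofReal_add, Complex.ofReal_mul]
  rw [ofReal_FC_re, t1, hP, t2]
  push_cast
  ring

/-! ### The series over n and m -/

/-- With u = 2πn/(mx) the bracket is 2g(-u), so evenness of g is what makes it the sample at u. -/
theorem innerTerm_eq {x y : ℝ} (hx : 0 < x) {m : ℕ} (hm : 0 < m) (n : ℕ) :
    innerTerm x y m (n + 1) = 2 * damped y (2 * Real.pi / (m * x) * ((n : ℝ) + 1)) := by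
  have hm' : (0 : ℝ) < m := Nat.cast_pos.2 hm
  set u : ℝ := 2 * Real.pi / (m * x) * ((n : ℝ) + 1) with hu
  have hu0 : 0 < u := by positivity
  have hmx : (m * x : ℝ) ≠ 0 := by positivity
  have e1 : -(2 * ((n + 1 : ℕ) : ℝ) * Real.pi * y) / (m * x) = -(y * |u|) := by
    rw [abs_of_pos hu0, hu]
    push_cast
    field_simp
  have e2 : Real.pi * ((n + 1 : ℕ) : ℝ) / (m * x) = -(-u) / 2 := by
    rw [hu]
    push_cast
    field_simp
  have e3 : -(Real.pi * ((n + 1 : ℕ) : ℝ)) / (m * x) = -u / 2 := by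
    rw [neg_div, e2]
    ring
  have e4 : -(4 * Real.pi * ((n + 1 : ℕ) : ℝ)) / (m * x) = 2 * -u := by
    rw [neg_div, mul_assoc, mul_div_assoc, e2]
    ring
  rw [innerTerm, e1, e2, e3, e4, damped, ← gfun_neg u, gfun]
  ring

/-- The step 2π/(mx) has dual lattice spacing mx, and division by m turns 1/h into x/(2π), free of
m. -/
theorem outerTerm_eq {x y : ℝ} (hx : 0 < x) (hy : 0 < y) (m : ℕ) :
    outerTerm x y m = (μ m : ℝ) * (x / (2 * Real.pi) * (FC 0 y).re +
      ∑' k : ℕ, x / Real.pi * (FC (((m * (k + 1) : ℕ) : ℝ) * x) y).re - damped y 0 / m) := by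
  rcases Nat.eq_zero_or_pos m with rfl | hm
  -- At m = 0 both sides vanish because μ(0) = 0.
  · simp [outerTerm]
  have hm' : (0 : ℝ) < m := Nat.cast_pos.2 hm
  have hh : 0 < 2 * Real.pi / (m * x) := by positivity
  have hP := poisson_summation_damped hy hh
  have e : ∀ k : ℕ, 2 * Real.pi / (2 * Real.pi / (m * x)) * ((k : ℝ) + 1) =
      ((m * (k + 1) : ℕ) : ℝ) * x := by
    intro k
    push_cast
    field_simp
  simp_rw [e] at hP
  rw [outerTerm, tsum_mul_left]
  simp_rw [innerTerm_eq hx hm]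
  rw [tsum_mul_left, ← add_sub_cancel_left (damped y 0) (2 * _), hP]
  field_simp

theorem hasPSum_outerTerm {x y : ℝ} (hx : 0 < x) (hy : 0 < y) :
    HasPSum (outerTerm x y) (x / Real.pi * (FC x y).re) := by
  have hc : Summable fun j : ℕ => x / Real.pi * (FC ((j : ℝ) * x) y).re := by
    refine Summable.mul_left _ ((summable_nat_add_iff 1).1 ?_)
    refine (summable_FC_re hy hx).congr fun n => ?_
    push_cast
    rw [mul_comm]
  have h := hasPSum_moebius hc (x / (2 * Real.pi) * (FC 0 y).re) (damped y 0)
  have e : outerTerm x y = _ := funext (outerTerm_eq hx hy)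
  rw [e]
  simpa using h

theorem ofReal_pi_div_mul_pSum {x y : ℝ} (hx : 0 < x) (hy : 0 < y) :
    ((Real.pi / x * pSum (outerTerm x y) : ℝ) : ℂ) = FC x y := by
  rw [(hasPSum_outerTerm hx hy).pSum_eq]
  conv_rhs => rw [← ofReal_FC_re]
  congr 1
  field_simp

/-- The Laplace value involves the Mellin transform at (1/2 - y)/2. The symmetric formula at s = y +
1/2 trades it for the one at s/2, which is the gamma series, and the completed zeta value; the terms
1/s cancel. -/
theorem FC_zero_left_eq {y : ℝ} (hy : 0 < y) (hy2 : y ≠ 1 / 2) :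
    FC 0 y = 1 / ((y : ℂ) - 1 / 2)
      - 2 * xi ((y : ℂ) + 1 / 2) / (((y : ℂ) + 1 / 2) * ((y : ℂ) - 1 / 2))
      + ((Real.pi ^ (-(y + 1 / 2) / 2) * ∑' n : ℕ, gammaTerm (y + 1 / 2) (n + 1) : ℝ) : ℂ) := by
  have hs : 0 < ((y : ℂ) + 1 / 2).re := by
    rw [Complex.add_re, Complex.ofReal_re]
    norm_num
    linarith
  have h1 : ((y : ℂ) + 1 / 2) ≠ 0 := fun h => by rw [h] at hs; simp at hs
  have h2 : ((y : ℂ) - 1 / 2) ≠ 0 := by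
    have : ((y : ℂ) - 1 / 2) = ((y - 1 / 2 : ℝ) : ℂ) := by push_cast; ring
    rw [this]
    exact Complex.ofReal_ne_zero.2 (sub_ne_zero.2 hy2)
  have h3 : (1 / 2 - (y : ℂ)) ≠ 0 := fun h => h2 (by linear_combination -h)
  rw [← mellin_psiTail_ofReal, xi_eq hs, completedRiemannZeta_eq_mellin, FC_zero_left hy]
  have e1 : (1 - ((y : ℂ) + 1 / 2)) = 1 / 2 - y := by ring
  have e2 : (y : ℂ) + 1 / 2 - 1 = y - 1 / 2 := by ring
  rw [e1, e2]
  push_cast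
  have e3 : ∀ L : ℂ, 2 * (1 / 2 * ((y : ℂ) + 1 / 2) * ((y : ℂ) - 1 / 2) * L) /
      (((y : ℂ) + 1 / 2) * ((y : ℂ) - 1 / 2)) = L := by
    intro L
    rw [div_eq_iff (mul_ne_zero h1 h2)]
    ring
  have e4 : 1 / (1 / 2 - (y : ℂ)) = -(1 / ((y : ℂ) - 1 / 2)) := by
    rw [← neg_sub, div_neg]
  rw [e3, e4, add_comm (1 / 2 : ℂ) y]
  ring

end XiHarmonic

end

theorem theorem3p2 :
    -- the expansion of the harmonic continuation, with the convergence it presupposes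
    (∀ x y : ℝ, 0 < x → 0 < y →
      MeasureTheory.Integrable (XiHarmonic.poissonIntegrand XiHarmonic.f x y) ∧
      (∀ m : ℕ, 1 ≤ m → Summable fun n : ℕ => XiHarmonic.innerTerm x y m (n + 1)) ∧
      XiHarmonic.PSummable (XiHarmonic.outerTerm x y) ∧
      XiHarmonic.harmonicContinuation XiHarmonic.f x y =
        ((Real.pi / x * XiHarmonic.pSum (XiHarmonic.outerTerm x y) : ℝ) : ℂ)) ∧
    -- the limit `y → 0`
    (∀ x : ℝ, 0 < x →
      Filter.Tendsto
        (fun y : ℝ => ((Real.pi / x * XiHarmonic.pSum (XiHarmonic.outerTerm x y) : ℝ) : ℂ))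
        (nhdsWithin 0 (Set.Ioi 0))
        (nhds (XiHarmonic.Xi x / ((x : ℂ) ^ 2 + 1 / 4)))) ∧
    -- the limit `x → 0`
    (∀ y : ℝ, 0 < y → y ≠ 1 / 2 →
      (Summable fun n : ℕ => XiHarmonic.gammaTerm (y + 1 / 2) (n + 1)) ∧
      Filter.Tendsto
        (fun x : ℝ => ((Real.pi / x * XiHarmonic.pSum (XiHarmonic.outerTerm x y) : ℝ) : ℂ))
        (nhdsWithin 0 (Set.Ioi 0))
        (nhds (1 / ((y : ℂ) - 1 / 2)
          - 2 * XiHarmonic.xi ((y : ℂ) + 1 / 2) / (((y : ℂ) + 1 / 2) * ((y : ℂ) - 1 / 2))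
          + ((Real.pi ^ (-(y + 1 / 2) / 2) *
              ∑' n : ℕ, XiHarmonic.gammaTerm (y + 1 / 2) (n + 1) : ℝ) : ℂ)))) := by
  refine ⟨fun x y hx hy => ⟨XiHarmonic.integrable_poissonIntegrand_f x hy, fun m hm => ?_,
    ⟨_, XiHarmonic.hasPSum_outerTerm hx hy⟩, ?_⟩, fun x hx => ?_, fun y hy hy2 => ⟨?_, ?_⟩⟩
  · have hm' : (0 : ℝ) < m := Nat.cast_pos.2 hm
    refine ((XiHarmonic.summable_damped hy.le
      (h := 2 * Real.pi / (m * x)) (by positivity)).mul_left 2).congr fun n => ?_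
    exact (XiHarmonic.innerTerm_eq hx hm n).symm
  · rw [XiHarmonic.ofReal_pi_div_mul_pSum hx hy, XiHarmonic.harmonicContinuation_f x hy]
  · have h := XiHarmonic.tendsto_FC (l := nhdsWithin (0 : ℝ) (Set.Ioi 0)) (a := fun _ => x)
      (b := fun y => y) (y := 0) tendsto_const_nhds
      (Filter.tendsto_id.mono_left nhdsWithin_le_nhds)
      (by filter_upwards [self_mem_nhdsWithin] with y hy using le_of_lt hy)
    rw [XiHarmonic.FC_zero_right] at h
    refine h.congr' ?_
    filter_upwards [self_mem_nhdsWithin] with y hy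
    exact (XiHarmonic.ofReal_pi_div_mul_pSum hx hy).symm
  · exact (XiHarmonic.hasSum_gammaTerm (y + 1 / 2)).summable
  · have h := XiHarmonic.tendsto_FC (l := nhdsWithin (0 : ℝ) (Set.Ioi 0)) (a := fun x => x)
      (b := fun _ => y) (x := 0) (Filter.tendsto_id.mono_left nhdsWithin_le_nhds)
      tendsto_const_nhds (Filter.Eventually.of_forall fun _ => hy.le)
    rw [XiHarmonic.FC_zero_left_eq hy hy2] at h
    refine h.congr' ?_
    filter_upwards [self_mem_nhdsWithin] with x hx
    exact (XiHarmonic.ofReal_pi_div_mul_pSum hx hy).symm
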